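/- For each $n$, let the edges of the complete graph on $n$ vertices carry i.i.d. weights with the exponential distribution of mean $1$. We consider both the complete directed graph (one weight for each ordered pair of distinct vertices; cycles are directed cycles through $k\ge 2$ distinct vertices) and the complete undirected graph (one weight for each unordered pair of distinct vertices; cycles pass through $k\ge 3$ distinct vertices). The mean weight of a cycle is the sum of its edge weights divided by the number of its edges. Let $T(z)=\sum_{k=1}^\infty k^{k-1}z^k/k!$ be the tree function; the series converges for $|z|\le 1/e$. Let $c\ge 0$ be fixed. For the complete directed graph, $$\lim_{n\to\infty}\Pr[\exists\text{ cycle with mean weight}\le c/n]=F_{\mathrm{dir}}(c):=\begin{cases}1-\exp[-T(c)+c] & c\le 1/e,\\ 1 & c>1/e,\end{cases}$$ and for the complete undirected graph, $$\lim_{n\to\infty}\Pr[\exists\text{ cycle with mean weight}\le c/n]=F_{\mathrm{und}}(c):=\begin{cases}1-\exp[(-T(c)+c+c^2)/2] & c\le 1/e,\\ 1 & c>1/e.\end{cases}$$ In particular each of $F=F_{\mathrm{dir}},F_{\mathrm{und}}$ jumps at $c=1/e$: its left limit there is $F(1/e)<1$, and its right limit there is $1$. -/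

import Mathlib

open MeasureTheory ProbabilityTheory Filter Topology

namespace MinMeanCycle

noncomputable section

/-- The tree function `T(z) = ∑_{k ≥ 1} k^(k-1) z^k / k!`; the summation index is shifted by one. -/
def treeFunction (z : ℝ) : ℝ :=
  ∑' k : ℕ, ((k + 1 : ℕ) : ℝ) ^ k * z ^ (k + 1) / ((k + 1).factorial : ℝ)

/-- The series defining the tree function converges for `|z| ≤ 1/e`. -/
theorem summable_treeFunction {z : ℝ} (hz : |z| ≤ 1 / Real.exp 1) :
    Summable fun k : ℕ => ((k + 1 : ℕ) : ℝ) ^ k * z ^ (k + 1) / ((k + 1).factorial : ℝ) := by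
  have hs : Summable fun k : ℕ => 1 / (((k + 1 : ℕ) : ℝ) ^ (3 / 2 : ℝ)) :=
    (summable_nat_add_iff 1).2 (Real.summable_one_div_nat_rpow.2 (by norm_num))
  refine Summable.of_norm_bounded hs fun k => ?_
  have hm : (0 : ℝ) < ((k + 1 : ℕ) : ℝ) := by positivity
  have hst := Stirling.le_factorial_stirling (k + 1)
  set m : ℝ := ((k + 1 : ℕ) : ℝ) with hmdef
  have he := Real.exp_pos 1
  have hsq : √m ≤ √(2 * Real.pi * m) := by
    apply Real.sqrt_le_sqrt
    nlinarith [Real.pi_gt_three]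
  have hf : √m * (m / Real.exp 1) ^ (k + 1) ≤ ((k + 1).factorial : ℝ) :=
    (mul_le_mul_of_nonneg_right hsq (by positivity)).trans hst
  have hpow : m ^ (3 / 2 : ℝ) = m * √m := by
    rw [Real.sqrt_eq_rpow, ← Real.rpow_one_add' hm.le (by norm_num)]
    norm_num
  rw [norm_div, norm_mul, norm_pow, norm_pow, Real.norm_eq_abs, Real.norm_eq_abs, Real.norm_eq_abs,
    abs_of_pos hm, abs_of_nonneg (by positivity : (0 : ℝ) ≤ ((k + 1).factorial : ℝ)), hpow]
  have hzp : |z| ^ (k + 1) ≤ (1 / Real.exp 1) ^ (k + 1) :=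
    pow_le_pow_left₀ (abs_nonneg z) hz _
  rw [div_le_div_iff₀ (by positivity) (by positivity), one_mul]
  calc m ^ k * |z| ^ (k + 1) * (m * √m)
      ≤ m ^ k * (1 / Real.exp 1) ^ (k + 1) * (m * √m) := by gcongr
    _ = √m * (m / Real.exp 1) ^ (k + 1) := by
        rw [div_pow, div_pow, one_pow, pow_succ m k]; ring
    _ ≤ _ := hf

/-- The family `W` of real random variables is i.i.d. with the exponential law of mean `1`. -/
def IsIIDExp {Ω ι : Type*} [MeasurableSpace Ω] (P : Measure Ω) (W : ι → Ω → ℝ) : Prop :=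
  (∀ e, HasLaw (W e) (expMeasure 1) P) ∧ iIndepFun W P

/-! ### Directed graphs -/

/-- The arcs of the complete directed graph on `V`: ordered pairs of distinct vertices. -/
abbrev Arc (V : Type*) : Type _ := {a : V × V // a.1 ≠ a.2}

/-- A directed cycle of length `k ≥ 2` in the complete directed graph on `V`, given by its
pairwise distinct vertices `v₀ → v₁ → ⋯ → v_{k-1} → v₀` (with a chosen starting vertex). -/
structure DirectedCycle (V : Type*) (k : ℕ) where
  two_le : 2 ≤ k
  vertex : Fin k → V
  injective : Function.Injective vertex

theorem finRotate_ne_self {k : ℕ} (hk : 2 ≤ k) (i : Fin k) : finRotate k i ≠ i := by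
  obtain ⟨m, rfl⟩ := Nat.exists_eq_add_of_le' hk
  have h : i ∈ (finRotate (m + 2)).support := by rw [support_finRotate]; exact Finset.mem_univ i
  exact Equiv.Perm.mem_support.1 h

/-- The `i`-th arc `vᵢ → vᵢ₊₁` of a directed cycle, the index `i + 1` being taken modulo `k`. -/
def DirectedCycle.arc {V : Type*} {k : ℕ} (C : DirectedCycle V k) (i : Fin k) : Arc V :=
  ⟨(C.vertex i, C.vertex (finRotate k i)), fun h =>
    finRotate_ne_self C.two_le i (C.injective h).symm⟩

/-- The mean weight of a directed cycle: total weight of its arcs divided by its length. -/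
def DirectedCycle.meanWeight {V : Type*} {k : ℕ} (C : DirectedCycle V k) (w : Arc V → ℝ) : ℝ :=
  (∑ i, w (C.arc i)) / k

/-- The weighted complete directed graph has a directed cycle of mean weight at most `x`. -/
def HasLightDirectedCycle {V : Type*} (w : Arc V → ℝ) (x : ℝ) : Prop :=
  ∃ (k : ℕ) (C : DirectedCycle V k), C.meanWeight w ≤ x

/-! ### Undirected graphs -/

/-- The edges of the complete undirected graph on `V`. -/
abbrev Edge (V : Type*) : Type _ := (⊤ : SimpleGraph V).edgeSet

/-- The mean weight of a walk: total weight of its edges divided by its length. -/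
def walkMeanWeight {V : Type*} (w : Edge V → ℝ) {u v : V} (p : (⊤ : SimpleGraph V).Walk u v) : ℝ :=
  (p.edges.attach.map fun e => w ⟨e.1, p.edges_subset_edgeSet e.2⟩).sum / p.length

/-- The weighted complete undirected graph has a cycle of mean weight at most `x`. -/
def HasLightCycle {V : Type*} (w : Edge V → ℝ) (x : ℝ) : Prop :=
  ∃ (u : V) (p : (⊤ : SimpleGraph V).Walk u u), p.IsCycle ∧ walkMeanWeight w p ≤ x

/-! ### The limiting distribution functions (for `c ≥ 0`) -/

def directedLimit (c : ℝ) : ℝ :=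
  if c ≤ 1 / Real.exp 1 then 1 - Real.exp (-treeFunction c + c) else 1

def undirectedLimit (c : ℝ) : ℝ :=
  if c ≤ 1 / Real.exp 1 then 1 - Real.exp ((-treeFunction c + c + c ^ 2) / 2) else 1

/-- `F` jumps at `a` from the value `F a < 1`, which is its left limit, to the right limit `1`. -/
def JumpsToOneAt (F : ℝ → ℝ) (a : ℝ) : Prop :=
  F a < 1 ∧ Tendsto F (𝓝[<] a) (𝓝 (F a)) ∧ Tendsto F (𝓝[>] a) (𝓝 1)

end

end MinMeanCycle

/-!
For a fixed length `k`, the complete graph on `n` vertices has `(n)_k / k` directed or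
`(n)_k / (2k)` undirected cycles of length `k`, and each of them has mean weight at most `c / n`
with probability asymptotic to `(kc / n)^k / k!`, because its total weight is a gamma variable.
Two light cycles that share a vertex force more light edges than vertices, which makes such pairs
negligible, so the Chen–Stein bound shows that the number of light cycles of length at most `K` is
asymptotically Poisson with mean `∑_{k ≤ K} k^(k-1) c^k / k!`, resp. half of it, summed over the
admissible `k`.

If `c ≤ 1/e` this series converges, to `T(c) - c` resp. `(T(c) - c - c²) / 2`; since its tail
dominates the expected number of light cycles longer than `K`, one may let `K → ∞`. If `c > 1/e`
the series diverges, and already the short cycles make a light cycle exist with high probability.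
-/

namespace MinMeanCycle

open scoped Finset

noncomputable section

/-! ### The Chen–Stein method -/

section ChenStein

/-- A solution `f` of the Stein equation `l f(w + 1) - w f(w) = 𝟙[w = 0] - e⁻ˡ` for the Poisson law
of mean `l` and the set `{0}`. Its value at `0` is irrelevant. -/
def steinSolution (l : ℝ) (w : ℕ) : ℝ :=
  ∫ t in (0 : ℝ)..1, t ^ (w - 1) * Real.exp (-(l * t))

theorem steinSolution_mem_Icc {l : ℝ} (hl : 0 ≤ l) (w : ℕ) :
    steinSolution l w ∈ Set.Icc (0 : ℝ) 1 := by
  have hnonneg : ∀ t ∈ Set.Icc (0 : ℝ) 1, 0 ≤ t ^ (w - 1) * Real.exp (-(l * t)) := fun t ht =>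
    mul_nonneg (pow_nonneg ht.1 _) (Real.exp_pos _).le
  have hle_one : ∀ t ∈ Set.Icc (0 : ℝ) 1, t ^ (w - 1) * Real.exp (-(l * t)) ≤ 1 := fun t ht =>
    mul_le_one₀ (pow_le_one₀ ht.1 ht.2) (Real.exp_pos _).le
      (Real.exp_le_one_iff.2 (neg_nonpos.2 (mul_nonneg hl ht.1)))
  have hint : Continuous fun t : ℝ => t ^ (w - 1) * Real.exp (-(l * t)) := by fun_prop
  refine ⟨intervalIntegral.integral_nonneg zero_le_one hnonneg, ?_⟩
  simpa [steinSolution] using intervalIntegral.integral_mono_on zero_le_one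
    (hint.intervalIntegrable 0 1) (intervalIntegrable_const (μ := volume) (c := (1 : ℝ))) hle_one

theorem steinSolution_equation (l : ℝ) (w : ℕ) :
    l * steinSolution l (w + 1) - w * steinSolution l w =
      (if w = 0 then 1 else 0) - Real.exp (-l) := by
  have hderiv : ∀ t ∈ Set.uIcc (0 : ℝ) 1, HasDerivAt (fun t : ℝ => -(t ^ w * Real.exp (-(l * t))))
      (l * (t ^ w * Real.exp (-(l * t))) - w * (t ^ (w - 1) * Real.exp (-(l * t)))) t := by
    intro t _
    have hexp : HasDerivAt (fun t : ℝ => Real.exp (-(l * t)))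
        (Real.exp (-(l * t)) * (-(l * 1))) t :=
      ((hasDerivAt_id' t).const_mul l).fun_neg.exp
    exact ((hasDerivAt_pow w t).fun_mul hexp).fun_neg.congr_deriv (by ring)
  have hint : ∀ (a : ℝ) (m : ℕ),
      IntervalIntegrable (fun t : ℝ => a * (t ^ m * Real.exp (-(l * t)))) volume 0 1 := fun a m =>
    Continuous.intervalIntegrable (by fun_prop) 0 1
  have hFTC := intervalIntegral.integral_eq_sub_of_hasDerivAt hderiv
    ((hint l w).sub (hint w (w - 1)))
  rw [intervalIntegral.integral_sub (hint l w) (hint w (w - 1)),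
    intervalIntegral.integral_const_mul, intervalIntegral.integral_const_mul] at hFTC
  rw [steinSolution, steinSolution, Nat.add_sub_cancel, hFTC]
  simp only [one_pow, mul_one, one_mul, mul_zero, neg_zero, Real.exp_zero, zero_pow_eq]
  ring

variable {Ω ι : Type*}

open Classical in
/-- The number of events `A a`, `a ∈ s`, that occur at `ω`. -/
def eventCount (A : ι → Set Ω) (s : Finset ι) (ω : Ω) : ℕ :=
  #{a ∈ s | ω ∈ A a}

theorem eventCount_eq_sum_indicator (A : ι → Set Ω) (s : Finset ι) :
    eventCount A s = fun ω => ∑ a ∈ s, (A a).indicator 1 ω := by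
  classical
  ext ω
  simp [eventCount, Set.indicator_apply]

theorem eventCount_eq_zero_iff {A : ι → Set Ω} {s : Finset ι} {ω : Ω} :
    eventCount A s ω = 0 ↔ ∀ a ∈ s, ω ∉ A a := by
  classical simp [eventCount, Finset.filter_eq_empty_iff]

theorem eventCount_sdiff_add_eventCount [DecidableEq ι] (A : ι → Set Ω) {s t : Finset ι}
    (hts : t ⊆ s) (ω : Ω) : eventCount A (s \ t) ω + eventCount A t ω = eventCount A s ω := by
  simp only [eventCount_eq_sum_indicator]
  exact Finset.sum_sdiff hts

theorem eventCount_eq_one [DecidableEq ι] {A : ι → Set Ω} {s : Finset ι} {a : ι} (ha : a ∈ s)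
    {ω : Ω} (hω : ω ∈ A a) (h : ∀ b ∈ s.erase a, ω ∉ A b) : eventCount A s ω = 1 := by
  classical
  rw [eventCount, Finset.card_eq_one]
  refine ⟨a, Finset.eq_singleton_iff_unique_mem.2 ⟨by simp [ha, hω], fun b hb => ?_⟩⟩
  simp only [Finset.mem_filter] at hb
  by_contra hba
  exact h b (Finset.mem_erase.2 ⟨hba, hb.1⟩) hb.2

variable [MeasurableSpace Ω] {μ : Measure Ω}

theorem measurable_eventCount {A : ι → Set Ω} (hA : ∀ a, MeasurableSet (A a)) (s : Finset ι) :
    Measurable (eventCount A s) := by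
  rw [eventCount_eq_sum_indicator]
  exact Finset.measurable_fun_sum s fun a _ => measurable_one.indicator (hA a)

theorem abs_setIntegral_comp_sub_comp_le [IsFiniteMeasure μ] {β : Type*} {f : β → ℝ}
    (hf : ∀ x, f x ∈ Set.Icc (0 : ℝ) 1) (X Y : Ω → β) {s : Set Ω} (hs : MeasurableSet s) :
    |∫ ω in s, (f (X ω) - f (Y ω)) ∂μ| ≤ μ.real (s ∩ {ω | X ω ≠ Y ω}) := by
  rw [setIntegral_eq_of_subset_of_forall_sdiff_eq_zero (s := s ∩ {ω | X ω ≠ Y ω}) hs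
    Set.inter_subset_left]
  · have hbound : ∀ ω ∈ s ∩ {ω | X ω ≠ Y ω}, ‖f (X ω) - f (Y ω)‖ ≤ 1 := fun ω _ => by
      rw [Real.norm_eq_abs, abs_sub_le_iff]
      constructor <;> linarith [(hf (X ω)).1, (hf (X ω)).2, (hf (Y ω)).1, (hf (Y ω)).2]
    exact (norm_setIntegral_le_of_norm_le_const (measure_lt_top μ _) hbound).trans_eq (one_mul _)
  · intro ω hω
    have hXY : X ω = Y ω := not_not.1 fun hne => hω.2 ⟨hω.1, hne⟩
    rw [hXY, sub_self]

theorem setIntegral_comp_eq_mul_integral {f : ℕ → ℝ} {X : Ω → ℕ} (hX : Measurable X) {B : Set Ω}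
    (hB : MeasurableSet B) (hind : IndepFun (· ∈ B) X μ) :
    ∫ ω in B, f (X ω) ∂μ = μ.real B * ∫ ω, f (X ω) ∂μ := by
  classical
  have hind' : IndepFun (B.indicator fun _ => (1 : ℝ)) (fun ω => f (X ω)) μ :=
    hind.comp (φ := fun p : Prop => if p then (1 : ℝ) else 0) (ψ := f) .of_discrete .of_discrete
  have hmul := hind'.integral_fun_mul_eq_mul_integral
    (measurable_const.indicator hB).aestronglyMeasurable
    (measurable_from_nat.comp hX).aestronglyMeasurable
  rw [integral_indicator_const _ hB, smul_eq_mul, mul_one] at hmul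
  rw [← hmul, ← integral_indicator hB]
  congr 1 with ω
  simp [Set.indicator_apply]

variable [IsProbabilityMeasure μ] {A : ι → Set Ω}

theorem integrable_comp_of_mem_Icc {f : ℕ → ℝ} (hf : ∀ n, f n ∈ Set.Icc (0 : ℝ) 1)
    {X : Ω → ℕ} (hX : Measurable X) : Integrable (fun ω => f (X ω)) μ :=
  Integrable.of_mem_Icc 0 1 (measurable_from_nat.comp hX).aemeasurable
    (Eventually.of_forall fun ω => hf (X ω))

/-- One term of Stein's identity: `N` may be replaced by the count of the events outside `D`, which
is independent of `A a`. -/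
theorem abs_mul_integral_sub_setIntegral_le [DecidableEq ι] (hA : ∀ a, MeasurableSet (A a))
    {s D : Finset ι} (hDs : D ⊆ s) {a : ι} (haD : a ∈ D)
    (hind : IndepFun (· ∈ A a) (eventCount A (s \ D)) μ)
    {f : ℕ → ℝ} (hf : ∀ n, f n ∈ Set.Icc (0 : ℝ) 1) :
    |μ.real (A a) * ∫ ω, f (eventCount A s ω + 1) ∂μ - ∫ ω in A a, f (eventCount A s ω) ∂μ| ≤
      μ.real (A a) * ∑ b ∈ D, μ.real (A b) + ∑ b ∈ D.erase a, μ.real (A a ∩ A b) := by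
  set N := eventCount A s
  set M := eventCount A (s \ D)
  have hNM : ∀ ω, M ω + eventCount A D ω = N ω := eventCount_sdiff_add_eventCount A hDs
  have hNm : Measurable N := measurable_eventCount hA s
  have hMm : Measurable M := measurable_eventCount hA (s \ D)
  have hindep : ∫ ω in A a, f (M ω + 1) ∂μ = μ.real (A a) * ∫ ω, f (M ω + 1) ∂μ :=
    setIntegral_comp_eq_mul_integral (f := fun m => f (m + 1)) hMm (hA a) hind
  have hsplit : μ.real (A a) * ∫ ω, f (N ω + 1) ∂μ - ∫ ω in A a, f (N ω) ∂μ =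
      μ.real (A a) * (∫ ω, (f (N ω + 1) - f (M ω + 1)) ∂μ) +
        ∫ ω in A a, (f (M ω + 1) - f (N ω)) ∂μ := by
    have hfM := integrable_comp_of_mem_Icc hf (μ := μ) (hMm.add_const 1)
    rw [integral_sub (integrable_comp_of_mem_Icc hf (hNm.add_const 1)) hfM,
      integral_sub hfM.integrableOn (integrable_comp_of_mem_Icc hf hNm).integrableOn, hindep]
    ring
  have hfirst : |∫ ω, (f (N ω + 1) - f (M ω + 1)) ∂μ| ≤ ∑ b ∈ D, μ.real (A b) := by
    have h := abs_setIntegral_comp_sub_comp_le (μ := μ) hf (N · + 1) (M · + 1) MeasurableSet.univ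
    rw [setIntegral_univ, Set.univ_inter] at h
    refine h.trans ((measureReal_mono (fun ω hω => ?_) (measure_ne_top μ _)).trans
      (measureReal_biUnion_finset_le D fun b => A b))
    have hD : eventCount A D ω ≠ 0 := fun h0 => hω (by rw [← hNM ω, h0, add_zero])
    simpa [eventCount_eq_zero_iff] using hD
  have hsecond : |∫ ω in A a, (f (M ω + 1) - f (N ω)) ∂μ| ≤
      ∑ b ∈ D.erase a, μ.real (A a ∩ A b) := by
    refine (abs_setIntegral_comp_sub_comp_le hf (M · + 1) N (hA a)).trans
      ((measureReal_mono ?_ (measure_ne_top μ _)).trans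
        (measureReal_biUnion_finset_le (D.erase a) fun b => A a ∩ A b))
    rintro ω ⟨hωa, hω⟩
    by_contra hnone
    refine hω ?_
    rw [← hNM ω, eventCount_eq_one haD hωa fun b hb hωb =>
      hnone (Set.mem_biUnion hb ⟨hωa, hωb⟩)]
  rw [hsplit]
  refine (abs_add_le _ _).trans (add_le_add ?_ hsecond)
  rw [abs_mul, abs_of_nonneg measureReal_nonneg]
  gcongr

theorem measureReal_eventCount_eq_zero_sub_exp (hA : ∀ a, MeasurableSet (A a)) (s : Finset ι) :
    μ.real {ω | eventCount A s ω = 0} - Real.exp (-∑ a ∈ s, μ.real (A a)) =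
      ∑ a ∈ s, (μ.real (A a) *
          ∫ ω, steinSolution (∑ a ∈ s, μ.real (A a)) (eventCount A s ω + 1) ∂μ -
        ∫ ω in A a, steinSolution (∑ a ∈ s, μ.real (A a)) (eventCount A s ω) ∂μ) := by
  classical
  set l := ∑ a ∈ s, μ.real (A a) with hl
  set N := eventCount A s with hN
  have hf := steinSolution_mem_Icc (l := l) (Finset.sum_nonneg fun a _ => measureReal_nonneg)
  have hNm : Measurable N := measurable_eventCount hA s
  have hfN := integrable_comp_of_mem_Icc hf (μ := μ) hNm
  have hfN1 := integrable_comp_of_mem_Icc hf (μ := μ) (hNm.add_const 1)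
  have hN0 : MeasurableSet {ω | N ω = 0} := hNm (measurableSet_singleton 0)
  have hcount : ∀ ω, ∑ a ∈ s, (A a).indicator (fun ω => steinSolution l (N ω)) ω =
      N ω * steinSolution l (N ω) := fun ω => by
    simp only [Set.indicator_apply, ← Finset.sum_filter, Finset.sum_const, nsmul_eq_mul, hN,
      eventCount]
  have hint : Integrable (fun ω => ∑ a ∈ s, (A a).indicator (fun ω => steinSolution l (N ω)) ω) μ :=
    integrable_finsetSum _ fun a _ => hfN.indicator (hA a)
  calc μ.real {ω | N ω = 0} - Real.exp (-l)
      = ∫ ω, ({ω | N ω = 0}.indicator (fun _ => (1 : ℝ)) ω - Real.exp (-l)) ∂μ := by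
        rw [integral_sub ((integrable_const 1).indicator hN0) (integrable_const _),
          integral_indicator_const _ hN0]
        simp
    _ = ∫ ω, (l * steinSolution l (N ω + 1) -
          ∑ a ∈ s, (A a).indicator (fun ω => steinSolution l (N ω)) ω) ∂μ := by
        congr 1 with ω
        rw [hcount, steinSolution_equation]
        simp [Set.indicator_apply]
    _ = _ := by
        rw [integral_sub (hfN1.const_mul l) hint, integral_const_mul,
          integral_finsetSum _ fun a _ => hfN.indicator (hA a), Finset.sum_sub_distrib,
          ← Finset.sum_mul]
        simp only [integral_indicator (hA _), hl]

/-- The Chen–Stein bound: `D a` is a dependency neighbourhood of the event `A a`. -/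
theorem abs_measureReal_forall_notMem_sub_exp_le [DecidableEq ι]
    (hA : ∀ a, MeasurableSet (A a)) {s : Finset ι} {D : ι → Finset ι} (hDs : ∀ a ∈ s, D a ⊆ s)
    (hD : ∀ a ∈ s, a ∈ D a)
    (hind : ∀ a ∈ s, IndepFun (· ∈ A a) (eventCount A (s \ D a)) μ) :
    |μ.real {ω | ∀ a ∈ s, ω ∉ A a} - Real.exp (-∑ a ∈ s, μ.real (A a))| ≤
      ∑ a ∈ s, (μ.real (A a) * ∑ b ∈ D a, μ.real (A b) +
        ∑ b ∈ (D a).erase a, μ.real (A a ∩ A b)) := by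
  simp only [← eventCount_eq_zero_iff]
  rw [measureReal_eventCount_eq_zero_sub_exp hA]
  exact (Finset.abs_sum_le_sum_abs _ _).trans <| Finset.sum_le_sum fun a ha =>
    abs_mul_integral_sub_setIntegral_le hA (hDs a ha) (hD a ha) (hind a ha)
      (steinSolution_mem_Icc (Finset.sum_nonneg fun _ _ => measureReal_nonneg))

end ChenStein

/-! ### Sums of exponential weights -/

section ExponentialSums

theorem expMeasure_Iic_le {r q : ℝ} (hr : 0 < r) (hq : 0 ≤ q) :
    expMeasure r (Set.Iic q) ≤ ENNReal.ofReal (r * q) := by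
  have := isProbabilityMeasure_expMeasure hr
  rw [← ofReal_measureReal, ← cdf_eq_real, cdf_expMeasure_eq hr, if_pos hq]
  exact ENNReal.ofReal_le_ofReal (by linarith [Real.add_one_le_exp (-(r * q))])

theorem ae_nonneg_expMeasure (r : ℝ) : ∀ᵐ x ∂expMeasure r, 0 ≤ x := by
  have h : expMeasure r (Set.Iio 0) = 0 :=
    (withDensity_apply _ measurableSet_Iio).trans (lintegral_exponentialPDF_of_nonpos le_rfl)
  simpa [ae_iff, Set.Iio] using h

theorem lintegral_expMeasure (r : ℝ) {f : ℝ → ENNReal} (hf : Measurable f) :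
    ∫⁻ t, f t ∂expMeasure r =
      ∫⁻ t in Set.Ici 0, ENNReal.ofReal (r * Real.exp (-(r * t))) * f t := by
  have hdensity : Measurable (exponentialPDF r) :=
    (measurable_exponentialPDFReal r).ennreal_ofReal
  refine (lintegral_withDensity_eq_lintegral_mul volume hdensity hf).trans ?_
  rw [← lintegral_indicator measurableSet_Ici]
  refine lintegral_congr fun t => ?_
  by_cases ht : 0 ≤ t
  · simp [Set.indicator_of_mem (Set.mem_Ici.2 ht), exponentialPDF_of_nonneg ht]
  · simp [ht, exponentialPDF_of_neg (not_le.1 ht)]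

theorem conv_apply_Iic (μ ν : Measure ℝ) [SFinite ν] (x : ℝ) :
    (μ ∗ ν) (Set.Iic x) = ∫⁻ t, ν (Set.Iic (x - t)) ∂μ := by
  rw [← lintegral_indicator_one measurableSet_Iic,
    Measure.lintegral_conv (measurable_one.indicator measurableSet_Iic)]
  refine lintegral_congr fun t => ?_
  rw [← lintegral_indicator_one measurableSet_Iic]
  refine lintegral_congr fun y => ?_
  simp only [Set.indicator_apply, Set.mem_Iic, le_sub_iff_add_le, add_comm t y, Pi.one_apply]

theorem expMeasure_conv_apply_Iic (r : ℝ) {ν : Measure ℝ} [SFinite ν]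
    (hν : ∀ x < 0, ν (Set.Iic x) = 0) (x : ℝ) :
    (expMeasure r ∗ ν) (Set.Iic x) =
      ∫⁻ t in Set.Icc 0 x, ENNReal.ofReal (r * Real.exp (-(r * t))) * ν (Set.Iic (x - t)) := by
  have hmeas : Measurable fun t => ν (Set.Iic (x - t)) :=
    Antitone.measurable fun s t hst => measure_mono (Set.Iic_subset_Iic.2 (by linarith))
  rw [conv_apply_Iic, lintegral_expMeasure r hmeas, ← lintegral_indicator measurableSet_Ici,
    ← lintegral_indicator measurableSet_Icc]
  refine lintegral_congr fun t => ?_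
  rcases le_or_gt t x with htx | htx
  · simp [Set.indicator_apply, htx]
  · simp [Set.indicator_apply, hν (x - t) (by linarith)]

theorem lintegral_Icc_mul_sub_pow_div_factorial (k : ℕ) {a r x : ℝ} (ha : 0 ≤ a) (hr : 0 ≤ r)
    (hx : 0 ≤ x) :
    ∫⁻ t in Set.Icc 0 x, ENNReal.ofReal (a * (r * ((r * (x - t)) ^ k / k.factorial))) =
      ENNReal.ofReal (a * ((r * x) ^ (k + 1) / (k + 1).factorial)) := by
  rw [← ofReal_integral_eq_lintegral_ofReal]
  · congr 1
    simp only [mul_pow]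
    rw [integral_Icc_eq_integral_Ioc, ← intervalIntegral.integral_of_le hx,
      intervalIntegral.integral_const_mul, intervalIntegral.integral_const_mul,
      intervalIntegral.integral_div, intervalIntegral.integral_const_mul,
      intervalIntegral.integral_comp_sub_left (fun t => t ^ k), integral_pow, Nat.factorial_succ]
    push_cast
    field_simp
    ring
  · exact (by fun_prop : Continuous fun t : ℝ =>
      a * (r * ((r * (x - t)) ^ k / k.factorial))).continuousOn.integrableOn_Icc
  · refine (ae_restrict_iff' measurableSet_Icc).2 (Eventually.of_forall fun t ht => ?_)
    have htx : 0 ≤ x - t := sub_nonneg.2 ht.2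
    simp only [Pi.zero_apply]
    positivity

/-- `ν` is carried by `[0, ∞)` and its distribution function satisfies the bounds
`e⁻ʳˣ (rx)ᵏ / k! ≤ ν (-∞, x] ≤ (rx)ᵏ / k!` that hold for the sum of `k` independent exponential
variables of rate `r`. -/
structure ErlangBounds (r : ℝ) (k : ℕ) (ν : Measure ℝ) : Prop where
  of_neg : ∀ x < 0, ν (Set.Iic x) = 0
  le : ∀ x, 0 ≤ x → ν (Set.Iic x) ≤ ENNReal.ofReal ((r * x) ^ k / k.factorial)
  ge : ∀ x, 0 ≤ x →
    ENNReal.ofReal (Real.exp (-(r * x)) * ((r * x) ^ k / k.factorial)) ≤ ν (Set.Iic x)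

theorem ErlangBounds.dirac_zero {r : ℝ} (hr : 0 ≤ r) : ErlangBounds r 0 (Measure.dirac 0) where
  of_neg x hx := by simp [hx]
  le x hx := by simp [hx]
  ge x hx := by simpa [hx] using mul_nonneg hr hx

theorem ErlangBounds.expMeasure_conv {r : ℝ} (hr : 0 ≤ r) {k : ℕ} {ν : Measure ℝ} [SFinite ν]
    (h : ErlangBounds r k ν) : ErlangBounds r (k + 1) (expMeasure r ∗ ν) where
  of_neg x hx := by simp [expMeasure_conv_apply_Iic r h.of_neg, Set.Icc_eq_empty (not_le.2 hx)]
  le x hx := by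
    have hint := lintegral_Icc_mul_sub_pow_div_factorial k zero_le_one hr hx
    simp only [one_mul] at hint
    rw [expMeasure_conv_apply_Iic r h.of_neg, ← hint]
    refine setLIntegral_mono' measurableSet_Icc fun t ht => ?_
    have hexp : r * Real.exp (-(r * t)) ≤ r :=
      mul_le_of_le_one_right hr (Real.exp_le_one_iff.2 (neg_nonpos.2 (mul_nonneg hr ht.1)))
    exact (mul_le_mul' (ENNReal.ofReal_le_ofReal hexp)
      (h.le _ (sub_nonneg.2 ht.2))).trans_eq (ENNReal.ofReal_mul hr).symm
  ge x hx := by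
    rw [expMeasure_conv_apply_Iic r h.of_neg,
      ← lintegral_Icc_mul_sub_pow_div_factorial k (Real.exp_pos _).le hr hx]
    refine setLIntegral_mono' measurableSet_Icc fun t ht => ?_
    calc ENNReal.ofReal (Real.exp (-(r * x)) * (r * ((r * (x - t)) ^ k / k.factorial)))
        = ENNReal.ofReal (r * Real.exp (-(r * t))) *
            ENNReal.ofReal
              (Real.exp (-(r * (x - t))) * ((r * (x - t)) ^ k / k.factorial)) := by
          rw [← ENNReal.ofReal_mul (by positivity)]
          congr 1
          rw [show -(r * x) = -(r * t) + -(r * (x - t)) by ring, Real.exp_add]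
          ring
      _ ≤ _ := by gcongr; exact h.ge _ (sub_nonneg.2 ht.2)

end ExponentialSums

section ExponentialWeights

theorem indepFun_pi_of_dependsOn {ι : Type*} [Fintype ι] {X : ι → Type*}
    [∀ i, MeasurableSpace (X i)] (μ : ∀ i, Measure (X i)) [∀ i, IsProbabilityMeasure (μ i)]
    {β γ : Type*} [MeasurableSpace β] [MeasurableSpace γ] {S T : Finset ι} (hST : Disjoint S T)
    {f : (∀ i, X i) → β} {g : (∀ i, X i) → γ} (hf : Measurable f) (hg : Measurable g)
    (hfS : DependsOn f S) (hgT : DependsOn g T) : IndepFun f g (Measure.pi μ) := by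
  classical
  have hne : ∀ i, Nonempty (X i) := fun i => nonempty_of_isProbabilityMeasure (μ i)
  let x₀ : ∀ i, X i := fun i => (hne i).some
  have hcoord : iIndepFun (fun i (x : ∀ i, X i) => x i) (Measure.pi μ) :=
    iIndepFun_pi (X := fun i => (id : X i → X i)) fun _ => aemeasurable_id
  convert! (hcoord.indepFun_finset S T hST measurable_pi_apply).comp
    (hf.comp (measurable_updateFinset (x := x₀))) (hg.comp (measurable_updateFinset (x := x₀)))
    using 1
  · ext x
    exact hfS fun i hi => by simp [Function.updateFinset, Finset.mem_coe.1 hi]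
  · ext x
    exact hgT fun i hi => by simp [Function.updateFinset, Finset.mem_coe.1 hi]

instance : IsProbabilityMeasure (expMeasure 1) := isProbabilityMeasure_expMeasure one_pos

variable {E : Type*} [Fintype E]

variable (E) in
/-- The law of independent exponential weights of mean `1` indexed by `E`. -/
def expWeights : Measure (E → ℝ) :=
  Measure.pi fun _ => expMeasure 1

instance : IsProbabilityMeasure (expWeights E) := by
  unfold expWeights
  infer_instance

theorem iIndepFun_expWeights : iIndepFun (fun (e : E) (w : E → ℝ) => w e) (expWeights E) :=
  iIndepFun_pi (X := fun _ : E => (id : ℝ → ℝ)) fun _ => aemeasurable_id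

theorem measurePreserving_eval_expWeights (e : E) :
    MeasurePreserving (fun w : E → ℝ => w e) (expWeights E) (expMeasure 1) :=
  measurePreserving_eval (fun _ : E => expMeasure 1) e

theorem ae_nonneg_expWeights : ∀ᵐ w ∂expWeights E, ∀ e, 0 ≤ w e :=
  ae_all_iff.2 fun e =>
    (measurePreserving_eval_expWeights e).quasiMeasurePreserving.ae (ae_nonneg_expMeasure 1)

theorem erlangBounds_map_sum_expWeights (S : Finset E) :
    ErlangBounds 1 #S ((expWeights E).map fun w => ∑ e ∈ S, w e) := by
  classical
  induction S using Finset.induction_on with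
  | empty => simpa using ErlangBounds.dirac_zero zero_le_one
  | insert e S he ih =>
    have hindep : IndepFun (fun w : E → ℝ => w e) (fun w => ∑ e ∈ S, w e) (expWeights E) := by
      simpa only [Finset.sum_fn] using (iIndepFun_expWeights.indepFun_finsetSum_of_notMem
        (fun e => measurable_pi_apply e) he).symm
    have hconv := hindep.map_add_eq_map_conv_map (measurable_pi_apply e) (by fun_prop)
    rw [(measurePreserving_eval_expWeights e).map_eq] at hconv
    simp only [Finset.sum_insert he, Finset.card_insert_of_notMem he]
    exact hconv ▸ ih.expMeasure_conv zero_le_one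

theorem expWeights_sum_le_le (S : Finset E) {x : ℝ} (hx : 0 ≤ x) :
    (expWeights E).real {w | ∑ e ∈ S, w e ≤ x} ≤ x ^ #S / (#S).factorial := by
  have h := (erlangBounds_map_sum_expWeights S).le x hx
  rw [Measure.map_apply (by fun_prop) measurableSet_Iic, one_mul] at h
  exact ENNReal.toReal_le_of_le_ofReal (by positivity) h

theorem le_expWeights_sum_le (S : Finset E) {x : ℝ} (hx : 0 ≤ x) :
    Real.exp (-x) * (x ^ #S / (#S).factorial) ≤ (expWeights E).real {w | ∑ e ∈ S, w e ≤ x} := by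
  have h := (erlangBounds_map_sum_expWeights S).ge x hx
  rw [Measure.map_apply (by fun_prop) measurableSet_Iic, one_mul] at h
  exact (ENNReal.ofReal_le_iff_le_toReal (measure_ne_top _ _)).1 h

theorem expWeights_forall_le_le (S : Finset E) {q : ℝ} (hq : 0 ≤ q) :
    (expWeights E).real {w | ∀ e ∈ S, w e ≤ q} ≤ q ^ #S := by
  have hset : {w : E → ℝ | ∀ e ∈ S, w e ≤ q} = ⋂ e ∈ S, (fun w : E → ℝ => w e) ⁻¹' Set.Iic q := by
    ext w
    simp
  refine ENNReal.toReal_le_of_le_ofReal (by positivity) ?_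
  rw [hset, iIndepFun_expWeights.measure_inter_preimage_eq_mul (ι := E) S
    (sets := fun _ => Set.Iic q) fun _ _ => measurableSet_Iic, ENNReal.ofReal_pow hq,
    ← Finset.prod_const]
  refine Finset.prod_le_prod' fun e _ => ?_
  rw [(measurePreserving_eval_expWeights e).measure_preimage measurableSet_Iic.nullMeasurableSet]
  simpa using expMeasure_Iic_le one_pos hq

theorem expWeights_sum_le_inter_sum_le_le [DecidableEq E] (S T : Finset E) {x y q : ℝ}
    (hx : x ≤ q) (hy : y ≤ q) (hq : 0 ≤ q) :
    (expWeights E).real ({w | ∑ e ∈ S, w e ≤ x} ∩ {w | ∑ e ∈ T, w e ≤ y}) ≤ q ^ #(S ∪ T) := by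
  refine le_trans (ENNReal.toReal_mono (measure_ne_top _ _) (measure_mono_ae ?_))
    (expWeights_forall_le_le (S ∪ T) hq)
  filter_upwards [ae_nonneg_expWeights (E := E)] with w hw
  rintro ⟨hS, hT⟩ e he
  rcases Finset.mem_union.1 he with he | he
  · exact (Finset.single_le_sum (fun e _ => hw e) he).trans (hS.trans hx)
  · exact (Finset.single_le_sum (fun e _ => hw e) he).trans (hT.trans hy)

end ExponentialWeights

/-! ### Poisson approximation for systems of cycles -/

/-- A system of cycles, indexed by `ι`, on the vertex set `V` with edges in `E`. A cycle is encoded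
by its vertices and its edges; the fields are the combinatorial properties of the cycles of a
complete graph on which the Poisson approximation rests. -/
structure CycleSystem (V E ι : Type*) [DecidableEq V] [DecidableEq E] [Fintype ι] where
  verts : ι → Finset V
  edges : ι → Finset E
  card_edges : ∀ a, #(edges a) = #(verts a)
  nonempty : ∀ a, (verts a).Nonempty
  disjoint_edges : ∀ a b, Disjoint (verts a) (verts b) → Disjoint (edges a) (edges b)
  card_union_lt : ∀ a b, a ≠ b → ¬Disjoint (verts a) (verts b) →
    #(verts a ∪ verts b) < #(edges a ∪ edges b)
  card_subset_le : ∀ U : Finset V, #{a | verts a ⊆ U} ≤ (#U).factorial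

namespace CycleSystem

variable {V E ι : Type*} [DecidableEq V] [DecidableEq E] [Fintype ι] (𝒞 : CycleSystem V E ι)

/-- The event that the cycle `a` has mean weight at most `x`. -/
def light (x : ℝ) (a : ι) : Set (E → ℝ) :=
  {w | ∑ e ∈ 𝒞.edges a, w e ≤ #(𝒞.verts a) * x}

/-- The event that no cycle in `s` has mean weight at most `x`. -/
def noLight (x : ℝ) (s : Finset ι) : Set (E → ℝ) :=
  {w | ∀ a ∈ s, w ∉ 𝒞.light x a}

/-- The cycles whose length belongs to `t`. -/
def ofLength (t : Finset ℕ) : Finset ι :=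
  {a | #(𝒞.verts a) ∈ t}

variable {𝒞} in
theorem mem_ofLength {t : Finset ℕ} {a : ι} : a ∈ 𝒞.ofLength t ↔ #(𝒞.verts a) ∈ t := by
  simp [ofLength]

theorem measurableSet_light (x : ℝ) (a : ι) : MeasurableSet (𝒞.light x a) :=
  measurableSet_le (by fun_prop) measurable_const

theorem dependsOn_light (x : ℝ) (a : ι) : DependsOn (· ∈ 𝒞.light x a) (𝒞.edges a) :=
  fun w w' h => by simp only [light, Set.mem_ofPred_eq, Finset.sum_congr rfl h]

theorem card_filter_verts_union_eq_le (U : Finset V) :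
    #{p : ι × ι | 𝒞.verts p.1 ∪ 𝒞.verts p.2 = U} ≤ (#U).factorial ^ 2 := by
  have hsub : ({p : ι × ι | 𝒞.verts p.1 ∪ 𝒞.verts p.2 = U} : Finset (ι × ι)) ⊆
      ({a | 𝒞.verts a ⊆ U} : Finset ι) ×ˢ ({a | 𝒞.verts a ⊆ U} : Finset ι) := by
    intro p hp
    obtain rfl := (Finset.mem_filter.1 hp).2
    simp
  calc _ ≤ _ := Finset.card_le_card hsub
    _ = #{a | 𝒞.verts a ⊆ U} ^ 2 := by rw [Finset.card_product, sq]
    _ ≤ _ := Nat.pow_le_pow_left (𝒞.card_subset_le U) 2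

theorem sum_pow_card_verts_union_le [Fintype V] {s : Finset ι} {K : ℕ}
    (hK : ∀ a ∈ s, #(𝒞.verts a) ≤ K) {q : ℝ} (hq : 0 ≤ q) :
    ∑ a ∈ s, ∑ b ∈ s, q ^ #(𝒞.verts a ∪ 𝒞.verts b) ≤
      ((2 * K).factorial : ℝ) ^ 2 * Real.exp (Fintype.card V * q) := by
  have hfiber : ∀ U : Finset V, ∑ p ∈ s ×ˢ s with 𝒞.verts p.1 ∪ 𝒞.verts p.2 = U,
      q ^ #(𝒞.verts p.1 ∪ 𝒞.verts p.2) ≤ ((2 * K).factorial : ℝ) ^ 2 * q ^ #U := by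
    intro U
    rw [Finset.sum_congr rfl fun p hp => by rw [(Finset.mem_filter.1 hp).2], Finset.sum_const,
      nsmul_eq_mul]
    gcongr
    rcases Finset.eq_empty_or_nonempty {p ∈ s ×ˢ s | 𝒞.verts p.1 ∪ 𝒞.verts p.2 = U} with h | ⟨p, hp⟩
    · simp only [h, Finset.card_empty, Nat.cast_zero]
      positivity
    · obtain ⟨hps, rfl⟩ := Finset.mem_filter.1 hp
      obtain ⟨hp₁, hp₂⟩ := Finset.mem_product.1 hps
      have hU : #(𝒞.verts p.1 ∪ 𝒞.verts p.2) ≤ 2 * K := by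
        linarith [Finset.card_union_le (𝒞.verts p.1) (𝒞.verts p.2), hK _ hp₁, hK _ hp₂]
      exact_mod_cast
        (Finset.card_le_card (Finset.filter_subset_filter _ (Finset.subset_univ _))).trans
          ((𝒞.card_filter_verts_union_eq_le _).trans
            (Nat.pow_le_pow_left (Nat.factorial_le hU) 2))
  have hbinom : ∑ U : Finset V, q ^ #U = (q + 1) ^ Fintype.card V := by
    simpa using Fintype.sum_pow_mul_eq_add_pow V q 1
  calc ∑ a ∈ s, ∑ b ∈ s, q ^ #(𝒞.verts a ∪ 𝒞.verts b)
      = ∑ U : Finset V, ∑ p ∈ s ×ˢ s with 𝒞.verts p.1 ∪ 𝒞.verts p.2 = U,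
          q ^ #(𝒞.verts p.1 ∪ 𝒞.verts p.2) := by
        rw [Finset.sum_fiberwise (s ×ˢ s), Finset.sum_product]
    _ ≤ ∑ U : Finset V, ((2 * K).factorial : ℝ) ^ 2 * q ^ #U :=
        Finset.sum_le_sum fun U _ => hfiber U
    _ = ((2 * K).factorial : ℝ) ^ 2 * (q + 1) ^ Fintype.card V := by rw [← Finset.mul_sum, hbinom]
    _ ≤ ((2 * K).factorial : ℝ) ^ 2 * Real.exp (Fintype.card V * q) := by
        rw [Real.exp_nat_mul]
        gcongr
        exact Real.add_one_le_exp q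

section Probability

variable [Fintype E]

theorem indepFun_light_eventCount (x : ℝ) {a : ι} {s : Finset ι}
    (h : ∀ b ∈ s, Disjoint (𝒞.verts a) (𝒞.verts b)) :
    IndepFun (· ∈ 𝒞.light x a) (eventCount (𝒞.light x) s) (expWeights E) := by
  refine indepFun_pi_of_dependsOn _ (disjoint_compl_right (a := 𝒞.edges a))
    (𝒞.measurableSet_light x a).mem (measurable_eventCount (𝒞.measurableSet_light x) s)
    (𝒞.dependsOn_light x a) fun w w' hw => ?_
  have hlight : ∀ b ∈ s, (w ∈ 𝒞.light x b) = (w' ∈ 𝒞.light x b) := fun b hb =>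
    𝒞.dependsOn_light x b fun e he => hw e <| Finset.mem_coe.2 <| Finset.mem_compl.2 <|
      Finset.disjoint_right.1 (𝒞.disjoint_edges a b (h b hb)) he
  classical exact congrArg Finset.card (Finset.filter_congr fun b hb => (hlight b hb).to_iff)

theorem measureReal_light_le {x : ℝ} (hx : 0 ≤ x) (a : ι) :
    (expWeights E).real (𝒞.light x a) ≤
      (#(𝒞.verts a) * x) ^ #(𝒞.verts a) / (#(𝒞.verts a)).factorial := by
  simpa only [light, 𝒞.card_edges] using expWeights_sum_le_le (𝒞.edges a) (by positivity)

theorem le_measureReal_light {x : ℝ} (hx : 0 ≤ x) (a : ι) :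
    Real.exp (-(#(𝒞.verts a) * x)) *
        ((#(𝒞.verts a) * x) ^ #(𝒞.verts a) / (#(𝒞.verts a)).factorial) ≤
      (expWeights E).real (𝒞.light x a) := by
  simpa only [light, 𝒞.card_edges] using le_expWeights_sum_le (𝒞.edges a)
    (by positivity : 0 ≤ #(𝒞.verts a) * x)

section Pair

variable {x q : ℝ} (hq : 0 ≤ q) (hq1 : q ≤ 1) {a b : ι} (ha : #(𝒞.verts a) * x ≤ q)
  (hb : #(𝒞.verts b) * x ≤ q) (hab : ¬Disjoint (𝒞.verts a) (𝒞.verts b))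

include hq ha in
theorem measureReal_light_le_pow : (expWeights E).real (𝒞.light x a) ≤ q ^ #(𝒞.verts a) := by
  have h := expWeights_sum_le_inter_sum_le_le (𝒞.edges a) (𝒞.edges a) ha ha hq
  rwa [Set.inter_self, Finset.union_self, 𝒞.card_edges] at h

include hq hq1 ha hb hab

theorem measureReal_light_mul_le :
    (expWeights E).real (𝒞.light x a) * (expWeights E).real (𝒞.light x b) ≤
      q * q ^ #(𝒞.verts a ∪ 𝒞.verts b) := by
  have hinter : 0 < #(𝒞.verts a ∩ 𝒞.verts b) :=
    Finset.card_pos.2 (Finset.not_disjoint_iff_nonempty_inter.1 hab)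
  have hcard := Finset.card_union_add_card_inter (𝒞.verts a) (𝒞.verts b)
  calc _ ≤ q ^ #(𝒞.verts a) * q ^ #(𝒞.verts b) :=
        mul_le_mul (𝒞.measureReal_light_le_pow hq ha) (𝒞.measureReal_light_le_pow hq hb)
          measureReal_nonneg (by positivity)
    _ = q ^ (#(𝒞.verts a) + #(𝒞.verts b)) := (pow_add ..).symm
    _ ≤ q ^ (#(𝒞.verts a ∪ 𝒞.verts b) + 1) := pow_le_pow_of_le_one hq hq1 (by omega)
    _ = q * q ^ #(𝒞.verts a ∪ 𝒞.verts b) := pow_succ' ..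

theorem measureReal_light_inter_le (hne : a ≠ b) :
    (expWeights E).real (𝒞.light x a ∩ 𝒞.light x b) ≤ q * q ^ #(𝒞.verts a ∪ 𝒞.verts b) := by
  refine (expWeights_sum_le_inter_sum_le_le (𝒞.edges a) (𝒞.edges b) ha hb hq).trans ?_
  rw [← pow_succ']
  exact pow_le_pow_of_le_one hq hq1 (𝒞.card_union_lt a b hne hab)

end Pair

theorem abs_measureReal_noLight_sub_exp_le [Fintype V] {s : Finset ι} {K : ℕ}
    (hK : ∀ a ∈ s, #(𝒞.verts a) ≤ K) {x : ℝ} (hx : 0 ≤ x) (hKx : K * x ≤ 1) :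
    |(expWeights E).real (𝒞.noLight x s) -
        Real.exp (-∑ a ∈ s, (expWeights E).real (𝒞.light x a))| ≤
      2 * (K * x) * (((2 * K).factorial : ℝ) ^ 2 * Real.exp (Fintype.card V * (K * x))) := by
  classical
  set q := K * x
  have hq : 0 ≤ q := by positivity
  have hlen : ∀ a ∈ s, #(𝒞.verts a) * x ≤ q := fun a ha =>
    mul_le_mul_of_nonneg_right (by exact_mod_cast hK a ha) hx
  let D : ι → Finset ι := fun a => {b ∈ s | ¬Disjoint (𝒞.verts a) (𝒞.verts b)}
  have hmemD : ∀ {a b}, b ∈ D a ↔ b ∈ s ∧ ¬Disjoint (𝒞.verts a) (𝒞.verts b) := Finset.mem_filter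
  have hDs : ∀ a, D a ⊆ s := fun a => Finset.filter_subset _ _
  refine (abs_measureReal_forall_notMem_sub_exp_le (𝒞.measurableSet_light x) (fun a _ => hDs a)
    (fun a ha => hmemD.2 ⟨ha, fun h => (𝒞.nonempty a).ne_empty (disjoint_self.1 h)⟩)
    fun a _ => 𝒞.indepFun_light_eventCount x fun b hb => ?_).trans ?_
  · obtain ⟨hbs, hbD⟩ := Finset.mem_sdiff.1 hb
    exact not_not.1 fun h => hbD (hmemD.2 ⟨hbs, h⟩)
  have hpow : ∀ a b, 0 ≤ q * q ^ #(𝒞.verts a ∪ 𝒞.verts b) := fun a b => by positivity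
  have hmul : ∀ a ∈ s, (expWeights E).real (𝒞.light x a) *
      ∑ b ∈ D a, (expWeights E).real (𝒞.light x b) ≤
        ∑ b ∈ s, q * q ^ #(𝒞.verts a ∪ 𝒞.verts b) := fun a ha => by
    rw [Finset.mul_sum]
    refine (Finset.sum_le_sum fun b hb => ?_).trans
      (Finset.sum_le_sum_of_subset_of_nonneg (hDs a) fun b _ _ => hpow a b)
    obtain ⟨hb, hab⟩ := hmemD.1 hb
    exact 𝒞.measureReal_light_mul_le hq hKx (hlen a ha) (hlen b hb) hab
  have hinter : ∀ a ∈ s, ∑ b ∈ (D a).erase a, (expWeights E).real (𝒞.light x a ∩ 𝒞.light x b) ≤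
      ∑ b ∈ s, q * q ^ #(𝒞.verts a ∪ 𝒞.verts b) := fun a ha => by
    refine (Finset.sum_le_sum fun b hb => ?_).trans (Finset.sum_le_sum_of_subset_of_nonneg
      ((Finset.erase_subset _ _).trans (hDs a)) fun b _ _ => hpow a b)
    obtain ⟨hne, hb, hab⟩ := (Finset.mem_erase.trans (and_congr_right' hmemD)).1 hb
    exact 𝒞.measureReal_light_inter_le hq hKx (hlen a ha) (hlen b hb) hab hne.symm
  refine (Finset.sum_le_sum fun a ha => add_le_add (hmul a ha) (hinter a ha)).trans ?_
  simp only [← two_mul, ← Finset.mul_sum, mul_assoc]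
  gcongr
  exact 𝒞.sum_pow_card_verts_union_le hK hq

theorem measureReal_noLight_anti (x : ℝ) {s t : Finset ι} (hst : s ⊆ t) :
    (expWeights E).real (𝒞.noLight x t) ≤ (expWeights E).real (𝒞.noLight x s) :=
  measureReal_mono fun _ hw a ha => hw a (hst ha)

theorem measureReal_noLight_le_add_sum_sdiff [DecidableEq ι] (x : ℝ) (s t : Finset ι) :
    (expWeights E).real (𝒞.noLight x s) ≤
      (expWeights E).real (𝒞.noLight x t) + ∑ a ∈ t \ s, (expWeights E).real (𝒞.light x a) := by
  have hsub : 𝒞.noLight x s ⊆ 𝒞.noLight x t ∪ ⋃ a ∈ t \ s, 𝒞.light x a := by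
    refine fun w hw => or_iff_not_imp_left.2 fun h => ?_
    simp only [noLight, Set.mem_ofPred_eq, not_forall, not_not] at h
    obtain ⟨a, hat, ha⟩ := h
    exact Set.mem_biUnion (Finset.mem_coe.2 <| Finset.mem_sdiff.2 ⟨hat, fun has => hw a has ha⟩) ha
  calc _ ≤ _ := measureReal_mono hsub
    _ ≤ _ := measureReal_union_le _ _
    _ ≤ _ := by gcongr; exact measureReal_biUnion_finset_le _ _

end Probability

section Density

variable {ρ : ℕ → ℝ}

/-- The system has `ρ k * (|V|)_k` cycles of length `k`. -/
structure HasDensity [Fintype V] (ρ : ℕ → ℝ) : Prop where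
  nonneg : ∀ k, 0 ≤ ρ k
  card_eq : ∀ k, (#{a | #(𝒞.verts a) = k} : ℝ) = ρ k * (Fintype.card V).descFactorial k

/-- The limit, as `|V| → ∞`, of the expected number of cycles of length `k` and mean weight at most
`c / |V|` in a system of density `ρ`. -/
def lightIntensity (ρ : ℕ → ℝ) (c : ℝ) (k : ℕ) : ℝ :=
  ρ k * ((k * c) ^ k / k.factorial)

variable {𝒞} [Fintype V]

theorem HasDensity.lightIntensity_nonneg (h : 𝒞.HasDensity ρ) {c : ℝ} (hc : 0 ≤ c) (k : ℕ) :
    0 ≤ lightIntensity ρ c k :=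
  mul_nonneg (h.nonneg k) (by positivity)

theorem HasDensity.sum_ofLength (h : 𝒞.HasDensity ρ) (t : Finset ℕ) (g : ℕ → ℝ) :
    ∑ a ∈ 𝒞.ofLength t, g #(𝒞.verts a) =
      ∑ k ∈ t, ρ k * (Fintype.card V).descFactorial k * g k := by
  rw [← Finset.sum_fiberwise_of_maps_to (g := fun a => #(𝒞.verts a)) fun a ha => mem_ofLength.1 ha]
  refine Finset.sum_congr rfl fun k hk => ?_
  have hfiber : {a ∈ 𝒞.ofLength t | #(𝒞.verts a) = k} = ({a | #(𝒞.verts a) = k} : Finset ι) := by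
    ext a
    simp only [Finset.mem_filter, mem_ofLength, Finset.mem_univ, true_and, and_iff_right_iff_imp]
    rintro rfl
    exact hk
  rw [hfiber, Finset.sum_congr rfl fun a ha => by rw [(Finset.mem_filter.1 ha).2],
    Finset.sum_const, nsmul_eq_mul, h.card_eq]

variable [Fintype E]

theorem HasDensity.sum_measureReal_light_le (h : 𝒞.HasDensity ρ) {c : ℝ} (hc : 0 ≤ c)
    (t : Finset ℕ) :
    ∑ a ∈ 𝒞.ofLength t, (expWeights E).real (𝒞.light (c / Fintype.card V) a) ≤
      ∑ k ∈ t, lightIntensity ρ c k := by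
  refine (Finset.sum_le_sum fun a _ => 𝒞.measureReal_light_le (by positivity) a).trans ?_
  rw [h.sum_ofLength t fun k => (k * (c / Fintype.card V)) ^ k / k.factorial]
  refine Finset.sum_le_sum fun k _ => ?_
  rw [lightIntensity, mul_assoc, ← mul_div_assoc]
  have hcard : (Fintype.card V : ℝ) * (k * (c / Fintype.card V)) ≤ k * c := by
    rw [mul_left_comm, mul_div_left_comm]
    gcongr
    exact mul_le_of_le_one_right hc (div_self_le_one _)
  have hdesc : ((Fintype.card V).descFactorial k : ℝ) ≤ (Fintype.card V : ℝ) ^ k := by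
    exact_mod_cast Nat.descFactorial_le_pow _ k
  gcongr
  · exact h.nonneg k
  · calc _ ≤ (Fintype.card V : ℝ) ^ k * (k * (c / Fintype.card V)) ^ k := by gcongr
      _ = (Fintype.card V * (k * (c / Fintype.card V))) ^ k := (mul_pow ..).symm
      _ ≤ _ := by gcongr

theorem HasDensity.measureReal_noLight_ofLength_range_le (h : 𝒞.HasDensity ρ) {c : ℝ} (hc : 0 ≤ c)
    (hs : Summable (lightIntensity ρ c)) (K : ℕ) :
    (expWeights E).real (𝒞.noLight (c / Fintype.card V) (𝒞.ofLength (.range K))) ≤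
      (expWeights E).real (𝒞.noLight (c / Fintype.card V) .univ) +
        ∑' k, lightIntensity ρ c (K + k) := by
  classical
  set n := Fintype.card V
  have hlong : Finset.univ \ 𝒞.ofLength (.range K) ⊆ 𝒞.ofLength (.Ico K (n + 1)) := fun a ha => by
    have hn : #(𝒞.verts a) ≤ n := Finset.card_le_univ _
    simpa [mem_ofLength, Nat.lt_succ_iff, hn] using ha
  have hnonneg := h.lightIntensity_nonneg hc
  refine (𝒞.measureReal_noLight_le_add_sum_sdiff _ _ .univ).trans ?_
  gcongr
  calc _ ≤ ∑ a ∈ 𝒞.ofLength (.Ico K (n + 1)), (expWeights E).real (𝒞.light (c / n) a) :=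
        Finset.sum_le_sum_of_subset_of_nonneg hlong fun _ _ _ => measureReal_nonneg
    _ ≤ ∑ k ∈ .Ico K (n + 1), lightIntensity ρ c k := h.sum_measureReal_light_le hc _
    _ = ∑ k ∈ .range (n + 1 - K), lightIntensity ρ c (K + k) := Finset.sum_Ico_eq_sum_range ..
    _ ≤ _ := (hs.comp_injective (add_right_injective K)).sum_le_tsum _ fun k _ => hnonneg (K + k)

end Density

section Limit

theorem tendsto_descFactorial_mul_div_pow (k : ℕ) (y : ℝ) :
    Tendsto (fun n : ℕ => (n.descFactorial k : ℝ) * (y / n) ^ k) atTop (𝓝 (y ^ k)) := by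
  have hpow : ∀ᶠ n : ℕ in atTop, (n : ℝ) ^ k ≠ 0 := by
    filter_upwards [eventually_ne_atTop 0] with n hn
    positivity
  have hratio := (Asymptotics.isEquivalent_iff_tendsto_one hpow).1 (isEquivalent_descFactorial k)
  refine (one_mul (y ^ k) ▸ hratio.mul_const (y ^ k)).congr fun n => ?_
  simp only [Pi.div_apply, div_pow]
  ring

variable {E ι : ℕ → Type*} [∀ n, Fintype (E n)] [∀ n, DecidableEq (E n)] [∀ n, Fintype (ι n)]
  {ρ : ℕ → ℝ} {𝒞 : ∀ n, CycleSystem (Fin n) (E n) (ι n)} (h𝒞 : ∀ n, (𝒞 n).HasDensity ρ)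
  {c : ℝ} (hc : 0 ≤ c)

include h𝒞 hc

theorem tendsto_sum_measureReal_light (t : Finset ℕ) :
    Tendsto (fun n => ∑ a ∈ (𝒞 n).ofLength t, (expWeights (E n)).real ((𝒞 n).light (c / n) a))
      atTop (𝓝 (∑ k ∈ t, lightIntensity ρ c k)) := by
  let lower (n k : ℕ) : ℝ := ρ k * n.descFactorial k *
    (Real.exp (-(k * (c / n))) * ((k * (c / n)) ^ k / k.factorial))
  have hlower : ∀ k, Tendsto (lower · k) atTop (𝓝 (lightIntensity ρ c k)) := fun k => by
    have hexp : Tendsto (fun n : ℕ => Real.exp (-(k * (c / n)))) atTop (𝓝 1) := by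
      simpa [Function.comp_def] using (Real.continuous_exp.tendsto _).comp
        ((tendsto_const_div_atTop_nhds_zero_nat c).const_mul (k : ℝ)).neg
    have hdesc := ((tendsto_descFactorial_mul_div_pow k (k * c)).div_const k.factorial).const_mul
      (ρ k)
    refine (mul_one (lightIntensity ρ c k) ▸ hdesc.mul hexp).congr fun n => ?_
    simp only [lower, mul_div_assoc]
    ring
  refine tendsto_of_tendsto_of_tendsto_of_le_of_le (tendsto_finsetSum t fun k _ => hlower k)
    tendsto_const_nhds (fun n => ?_) fun n => ?_
  · have hsum := (h𝒞 n).sum_ofLength t fun k =>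
      Real.exp (-(k * (c / n))) * ((k * (c / n)) ^ k / k.factorial)
    rw [Fintype.card_fin] at hsum
    exact hsum.symm.trans_le
      (Finset.sum_le_sum fun a _ => (𝒞 n).le_measureReal_light (by positivity) a)
  · simpa only [Fintype.card_fin] using (h𝒞 n).sum_measureReal_light_le hc t

theorem tendsto_measureReal_noLight_ofLength (t : Finset ℕ) :
    Tendsto (fun n => (expWeights (E n)).real ((𝒞 n).noLight (c / n) ((𝒞 n).ofLength t))) atTop
      (𝓝 (Real.exp (-∑ k ∈ t, lightIntensity ρ c k))) := by
  obtain ⟨K, hK⟩ := t.bddAbove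
  have hKx : Tendsto (fun n : ℕ => K * (c / n)) atTop (𝓝 0) := by
    simpa using (tendsto_const_div_atTop_nhds_zero_nat c).const_mul (K : ℝ)
  have hbound : Tendsto (fun n : ℕ => 2 * (K * (c / n)) *
      (((2 * K).factorial : ℝ) ^ 2 * Real.exp (K * c))) atTop (𝓝 0) := by
    simpa using (hKx.const_mul 2).mul_const (((2 * K).factorial : ℝ) ^ 2 * Real.exp (K * c))
  have hpoisson := (Real.continuous_exp.tendsto _).comp (tendsto_sum_measureReal_light h𝒞 hc t).neg
  refine hpoisson.congr_dist (squeeze_zero' (.of_forall fun _ => dist_nonneg) ?_ hbound)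
  filter_upwards [eventually_ne_atTop 0, hKx.eventually (eventually_le_nhds one_pos)] with n hn hle
  have hn0 : (n : ℝ) ≠ 0 := Nat.cast_ne_zero.2 hn
  have hexpo : (n : ℝ) * (K * (c / n)) = K * c := by field_simp
  have happrox := (𝒞 n).abs_measureReal_noLight_sub_exp_le
    (fun a ha => hK (Finset.mem_coe.2 (mem_ofLength.1 ha))) (by positivity) hle
  rw [dist_comm]
  rwa [Fintype.card_fin, hexpo] at happrox

theorem tendsto_measureReal_noLight_of_not_summable (hs : ¬Summable (lightIntensity ρ c)) :
    Tendsto (fun n => (expWeights (E n)).real ((𝒞 n).noLight (c / n) .univ)) atTop (𝓝 0) := by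
  have hdiverge := (not_summable_iff_tendsto_nat_atTop_of_nonneg
    ((h𝒞 0).lightIntensity_nonneg hc)).1 hs
  refine tendsto_order.2 ⟨fun y hy => .of_forall fun n => hy.trans_le measureReal_nonneg,
    fun ε hε => ?_⟩
  obtain ⟨K, hK⟩ :=
    ((Real.tendsto_exp_neg_atTop_nhds_zero.comp hdiverge).eventually_lt_const hε).exists
  filter_upwards [(tendsto_measureReal_noLight_ofLength h𝒞 hc (.range K)).eventually_lt_const hK]
    with n hn
  exact ((𝒞 n).measureReal_noLight_anti _ (Finset.subset_univ _)).trans_lt hn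

theorem tendsto_measureReal_noLight_of_summable (hs : Summable (lightIntensity ρ c)) :
    Tendsto (fun n => (expWeights (E n)).real ((𝒞 n).noLight (c / n) .univ)) atTop
      (𝓝 (Real.exp (-∑' k, lightIntensity ρ c k))) := by
  have huniform : TendstoUniformly (fun K n => (expWeights (E n)).real
      ((𝒞 n).noLight (c / n) ((𝒞 n).ofLength (.range K))))
      (fun n => (expWeights (E n)).real ((𝒞 n).noLight (c / n) .univ)) atTop := by
    refine Metric.tendstoUniformly_iff.2 fun ε hε => ?_
    filter_upwards [(tendsto_sum_nat_add (lightIntensity ρ c)).eventually_lt_const hε]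
      with K hK n
    have hanti := (𝒞 n).measureReal_noLight_anti (c / n)
      (Finset.subset_univ ((𝒞 n).ofLength (.range K)))
    have htail := (h𝒞 n).measureReal_noLight_ofLength_range_le hc hs K
    rw [Fintype.card_fin] at htail
    simp only [add_comm _ K] at hK
    rw [dist_comm, Real.dist_eq, abs_of_nonneg (sub_nonneg.2 hanti)]
    linarith
  exact huniform.tendsto_of_eventually_tendsto
    (.of_forall fun K => tendsto_measureReal_noLight_ofLength h𝒞 hc (.range K))
    ((Real.continuous_exp.tendsto _).comp hs.hasSum.tendsto_sum_nat.neg)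

end Limit

end CycleSystem

/-! ### Cycles as permutations -/

section Permutations

open Equiv.Perm

variable {V E : Type*} {σ τ : Equiv.Perm V}

/-- The edge underlying an arc. -/
def Arc.edge (a : Arc V) : Edge V :=
  ⟨s(a.1.1, a.1.2), by simpa using a.2⟩

theorem Arc.edge_eq_edge_iff {a b : Arc V} :
    a.edge = b.edge ↔ a.1.1 = b.1.1 ∧ a.1.2 = b.1.2 ∨ a.1.1 = b.1.2 ∧ a.1.2 = b.1.1 := by
  rw [edge, edge, Subtype.mk.injEq, Sym2.eq_iff]

variable [DecidableEq V]

theorem card_union_lt_card_union_image [DecidableEq E] {A B : Finset V} {F : Finset E}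
    {φ : B → E} (hφ : Function.Injective φ) (hF : #F = #A) (hA : ∀ u, φ u ∈ F → ↑u ∈ A)
    {v : B} (hv : ↑v ∈ A) (hvF : φ v ∉ F) : #(A ∪ B) < #(F ∪ Finset.univ.image φ) := by
  have hlt : #{u : B | φ u ∈ F} < #{u : B | ↑u ∈ A} := by
    have hsub := Finset.monotone_filter_right Finset.univ fun u _ => hA u
    exact Finset.card_lt_card ((Finset.ssubset_iff_of_subset hsub).2
      ⟨v, by simpa using hv, by simpa using hvF⟩)
  have himage : #(F ∩ Finset.univ.image φ) = #{u : B | φ u ∈ F} := by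
    rw [Finset.inter_comm, ← Finset.filter_mem_eq_inter, Finset.filter_image,
      Finset.card_image_of_injective _ hφ]
  have hinter : #(A ∩ B) = #{u : B | ↑u ∈ A} := by
    rw [← Finset.card_map (.subtype (· ∈ B))]
    congr 1
    ext
    simp
  have hcard : #(Finset.univ.image φ) = #B := by
    rw [Finset.card_image_of_injective _ hφ, Finset.card_univ, Fintype.card_coe]
  have hAB := Finset.card_union_add_card_inter A B
  have hFB := Finset.card_union_add_card_inter F (Finset.univ.image φ)
  omega

variable [Fintype V]

theorem card_filter_support_subset_le (U : Finset V) :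
    #{σ : Equiv.Perm V | σ.support ⊆ U} ≤ (#U).factorial := by
  rw [← Fintype.card_coe U, ← Fintype.card_perm, ← Fintype.card_subtype]
  refine (Fintype.card_congr ((Equiv.subtypeEquivRight fun σ => ?_).trans
    (Equiv.Perm.subtypeEquivSubtypePerm (· ∈ U)).symm)).le
  simp only [Finset.subset_iff, mem_support, ← not_imp_comm]

/-- The arc `v → σ v` at a vertex moved by `σ`. -/
def permArc (σ : Equiv.Perm V) (v : σ.support) : Arc V :=
  ⟨(v, σ v), (mem_support.1 v.2).symm⟩

theorem permArc_injective (σ : Equiv.Perm V) : Function.Injective (permArc σ) :=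
  fun _ _ h => Subtype.ext (congrArg (fun a : Arc V => a.1.1) h)

variable [DecidableEq E] {g : Arc V → E}

/-- The images under `g` of the arcs of `σ`: taking `g = id` for the arcs themselves and
`g = Arc.edge` for the underlying edges treats directed and undirected cycles at once. -/
def permEdges (g : Arc V → E) (σ : Equiv.Perm V) : Finset E :=
  Finset.univ.image fun v => g (permArc σ v)

theorem mem_permEdges {e : E} : e ∈ permEdges g σ ↔ ∃ v, g (permArc σ v) = e := by
  simp [permEdges]

theorem card_permEdges (hinj : Function.Injective fun v => g (permArc σ v)) :
    #(permEdges g σ) = #σ.support := by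
  rw [permEdges, Finset.card_image_of_injective _ hinj, Finset.card_univ, Fintype.card_coe]

theorem sum_permEdges (hinj : Function.Injective fun v => g (permArc σ v)) (w : E → ℝ) :
    ∑ e ∈ permEdges g σ, w e = ∑ v, w (g (permArc σ v)) :=
  Finset.sum_image hinj.injOn

theorem mem_support_of_mem_permEdges (hg : Arc.edge.FactorsThrough g) {u : τ.support}
    (hu : g (permArc τ u) ∈ permEdges g σ) : ↑u ∈ σ.support := by
  obtain ⟨v, hv⟩ := mem_permEdges.1 hu
  obtain ⟨h, -⟩ | ⟨-, h⟩ := Arc.edge_eq_edge_iff.1 (hg hv)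
  · exact Set.mem_of_eq_of_mem h.symm v.2
  · exact Set.mem_of_eq_of_mem h.symm (apply_mem_support.2 v.2)

theorem disjoint_permEdges (hg : Arc.edge.FactorsThrough g)
    (h : Disjoint σ.support τ.support) :
    Disjoint (permEdges g σ) (permEdges g τ) := by
  refine Finset.disjoint_left.2 fun e hσ hτ => ?_
  obtain ⟨u, rfl⟩ := mem_permEdges.1 hτ
  exact Finset.disjoint_left.1 h (mem_support_of_mem_permEdges hg hσ) u.2

/-- A family of cyclic permutations forms a system of cycles as soon as any two of them that share a
vertex separate at some common vertex. -/
def CycleSystem.ofPerms (Q : Equiv.Perm V → Prop) [DecidablePred Q] (hQ : ∀ σ, Q σ → σ.IsCycle)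
    (g : Arc V → E) (hg : Arc.edge.FactorsThrough g)
    (hinj : ∀ σ, Q σ → Function.Injective fun v => g (permArc σ v))
    (hsep : ∀ σ τ, Q σ → Q τ → σ ≠ τ → ¬Disjoint σ.support τ.support →
      ∃ v : τ.support, ↑v ∈ σ.support ∧ g (permArc τ v) ∉ permEdges g σ) :
    CycleSystem V E {σ // Q σ} where
  verts σ := σ.1.support
  edges σ := permEdges g σ.1
  card_edges σ := card_permEdges (hinj σ.1 σ.2)
  nonempty σ := Finset.nonempty_iff_ne_empty.2 (support_eq_empty_iff.not.2 (hQ σ.1 σ.2).ne_one)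
  disjoint_edges _ _ := disjoint_permEdges hg
  card_union_lt σ τ hne hdisj := by
    obtain ⟨v, hv, hvσ⟩ := hsep σ.1 τ.1 σ.2 τ.2 (Subtype.coe_ne_coe.2 hne) hdisj
    exact card_union_lt_card_union_image (hinj τ.1 τ.2) (card_permEdges (hinj σ.1 σ.2))
      (fun _ => mem_support_of_mem_permEdges hg) hv hvσ
  card_subset_le U := (Finset.card_le_card_of_injOn Subtype.val (fun σ hσ => by simpa using hσ)
    Subtype.val_injective.injOn).trans (card_filter_support_subset_le U)

theorem card_filter_card_support_subtype (Q : Equiv.Perm V → Prop) [DecidablePred Q] (k : ℕ) :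
    #{σ : {σ // Q σ} | #σ.1.support = k} = #{σ | Q σ ∧ #σ.support = k} := by
  rw [← Fintype.card_subtype, ← Fintype.card_subtype]
  exact Fintype.card_congr (Equiv.subtypeSubtypeEquivSubtypeInter Q fun σ => #σ.support = k)

instance : DecidablePred (Equiv.Perm.IsCycle (α := V)) :=
  Classical.decPred _

theorem mul_card_filter_isCycle {k : ℕ} (hk : 2 ≤ k) :
    k * #{σ : Equiv.Perm V | σ.IsCycle ∧ #σ.support = k} = (Fintype.card V).descFactorial k := by
  have hcycleType : ∀ σ : Equiv.Perm V, σ.IsCycle ∧ #σ.support = k ↔ σ.cycleType = {k} := by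
    refine fun σ => ⟨fun h => by rw [h.1.cycleType, h.2], fun h => ?_⟩
    have hσ : σ.IsCycle := card_cycleType_eq_one.1 (h ▸ Multiset.card_singleton k)
    exact ⟨hσ, Multiset.singleton_inj.1 (hσ.cycleType.symm.trans h)⟩
  simp only [hcycleType]
  rcases le_or_gt k (Fintype.card V) with hkV | hkV
  · rw [card_of_cycleType_singleton hk hkV, Nat.descFactorial_eq_factorial_mul_choose, ← mul_assoc,
      Nat.mul_factorial_pred (by omega)]
  · rw [Nat.descFactorial_of_lt hkV, mul_eq_zero, Finset.card_eq_zero, Finset.filter_eq_empty_iff]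
    exact .inr fun σ _ h => hkV.not_ge (((hcycleType σ).2 h).2 ▸ Finset.card_le_univ _)

section Orientation

theorem apply_apply_ne_of_three_le (hσ : σ.IsCycle) (h3 : 3 ≤ #σ.support) {v : V}
    (hv : v ∈ σ.support) : σ (σ v) ≠ v := fun h => by
  rw [hσ.eq_swap_of_apply_apply_eq_self (mem_support.1 hv) h,
    card_support_swap (mem_support.1 hv).symm] at h3
  omega

theorem ne_inv_of_three_le (hσ : σ.IsCycle) (h3 : 3 ≤ #σ.support) : σ ≠ σ⁻¹ := fun h => by
  obtain ⟨v, hv⟩ := hσ.nonempty_support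
  refine apply_apply_ne_of_three_le hσ h3 hv ?_
  nth_rewrite 1 [h]
  exact σ.symm_apply_apply v

theorem eq_of_apply_eq_of_agree (hσ : σ.IsCycle) (hτ : τ.IsCycle) (h3 : 3 ≤ #τ.support)
    (h : ∀ v ∈ σ.support ∩ τ.support, τ v = σ v ∨ σ (τ v) = v) {v : V}
    (hvσ : v ∈ σ.support) (hvτ : v ∈ τ.support) (hv : τ v = σ v) : τ = σ := by
  -- Since `τ` has no 2-cycle, two cycles that leave `v` together never part afterwards.
  have hpow : ∀ n : ℕ, (τ ^ n) v ∈ σ.support ∧ τ ((τ ^ n) v) = σ ((τ ^ n) v) := by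
    intro n
    induction n with
    | zero => exact ⟨hvσ, hv⟩
    | succ n ih =>
      obtain ⟨hmem, heq⟩ := ih
      have hτmem : (τ ^ n) v ∈ τ.support := pow_apply_mem_support.2 hvτ
      rw [pow_succ', mul_apply]
      have hnext : τ ((τ ^ n) v) ∈ σ.support := heq ▸ apply_mem_support.2 hmem
      refine ⟨hnext, (h _ (Finset.mem_inter.2 ⟨hnext, apply_mem_support.2 hτmem⟩)).resolve_right
        fun hback => apply_apply_ne_of_three_le hτ h3 hτmem (σ.injective ?_)⟩
      rw [hback, heq]
  refine hτ.eq_on_support_inter_nonempty_congr hσ (fun u hu => ?_) hv hvτ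
  obtain ⟨n, rfl⟩ := hτ.exists_pow_eq (mem_support.1 hvτ)
    (mem_support.1 (Finset.mem_inter.1 hu).1)
  exact (hpow n).2

theorem eq_or_eq_inv_of_agree (hσ : σ.IsCycle) (hτ : τ.IsCycle) (h3 : 3 ≤ #τ.support)
    (hdisj : ¬Disjoint σ.support τ.support)
    (h : ∀ v ∈ σ.support ∩ τ.support, τ v = σ v ∨ σ (τ v) = v) : τ = σ ∨ τ = σ⁻¹ := by
  obtain ⟨v, hvσ, hvτ⟩ := Finset.not_disjoint_iff.1 hdisj
  refine (h v (Finset.mem_inter.2 ⟨hvσ, hvτ⟩)).imp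
    (eq_of_apply_eq_of_agree hσ hτ h3 h hvσ hvτ) fun hv => ?_
  refine eq_of_apply_eq_of_agree hσ.inv hτ h3 (fun u hu => ?_) (by rwa [support_inv]) hvτ
    (eq_inv_iff_eq.2 hv)
  rw [support_inv] at hu
  exact (h u hu).symm.imp eq_inv_iff_eq.2 fun h => inv_eq_iff_eq.2 h

theorem injective_edge_permArc (hσ : σ.IsCycle) (h3 : 3 ≤ #σ.support) :
    Function.Injective fun v => (permArc σ v).edge := by
  intro u v huv
  obtain ⟨h, -⟩ | ⟨h, h'⟩ := Arc.edge_eq_edge_iff.1 huv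
  · exact Subtype.ext h
  · exact absurd ((congrArg σ h).symm.trans h') (apply_apply_ne_of_three_le hσ h3 v.2)

theorem permEdges_edge_inv (σ : Equiv.Perm V) :
    permEdges Arc.edge σ⁻¹ = permEdges Arc.edge σ := by
  have hsubset : ∀ σ : Equiv.Perm V, permEdges Arc.edge σ⁻¹ ⊆ permEdges Arc.edge σ := by
    intro σ e he
    obtain ⟨v, rfl⟩ := mem_permEdges.1 he
    have hv : σ⁻¹ v ∈ σ.support := support_inv σ ▸ apply_mem_support.2 v.2
    exact mem_permEdges.2 ⟨⟨σ⁻¹ v, hv⟩,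
      Arc.edge_eq_edge_iff.2 (.inr ⟨rfl, σ.apply_symm_apply v⟩)⟩
  exact (hsubset σ).antisymm (by simpa using hsubset σ⁻¹)

/-- `σ` is the chosen one of the two orientations of an undirected cycle: the one that comes first
in an arbitrary enumeration of the permutations. -/
def IsChosenCycle (σ : Equiv.Perm V) : Prop :=
  σ.IsCycle ∧ 3 ≤ #σ.support ∧
    Fintype.equivFin (Equiv.Perm V) σ < Fintype.equivFin (Equiv.Perm V) σ⁻¹

instance : DecidablePred (IsChosenCycle (V := V)) :=
  Classical.decPred _

theorem isChosenCycle_or_inv (hσ : σ.IsCycle) (h3 : 3 ≤ #σ.support) :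
    IsChosenCycle σ ∨ IsChosenCycle σ⁻¹ :=
  (lt_or_gt_of_ne ((Fintype.equivFin _).injective.ne (ne_inv_of_three_le hσ h3))).imp
    (⟨hσ, h3, ·⟩) fun h => ⟨hσ.inv, by rwa [support_inv], by rwa [inv_inv]⟩

theorem IsChosenCycle.not_inv (h : IsChosenCycle σ) : ¬IsChosenCycle σ⁻¹ :=
  fun h' => h.2.2.asymm (by simpa using h'.2.2)

open scoped Pointwise in
theorem two_mul_card_filter_isChosenCycle {k : ℕ} (hk : 3 ≤ k) :
    2 * #{σ : Equiv.Perm V | IsChosenCycle σ ∧ #σ.support = k} =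
      #{σ : Equiv.Perm V | σ.IsCycle ∧ #σ.support = k} := by
  set A : Finset (Equiv.Perm V) := {σ | IsChosenCycle σ ∧ #σ.support = k} with hA
  have hunion : ({σ | σ.IsCycle ∧ #σ.support = k} : Finset (Equiv.Perm V)) = A ∪ A⁻¹ := by
    ext σ
    simp only [hA, Finset.mem_filter, Finset.mem_univ, true_and, Finset.mem_union, Finset.mem_inv',
      support_inv, ← or_and_right]
    refine and_congr_left fun h => ⟨fun hσ => isChosenCycle_or_inv hσ (hk.trans_eq h.symm), ?_⟩
    rintro (hσ | hσ)
    exacts [hσ.1, inv_inv σ ▸ hσ.1.inv]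
  have hdisj : Disjoint A A⁻¹ := Finset.disjoint_left.2 fun σ hσ hσ' =>
    (Finset.mem_filter.1 hσ).2.1.not_inv (Finset.mem_filter.1 (Finset.mem_inv'.1 hσ')).2.1
  rw [hunion, Finset.card_union_of_disjoint hdisj, Finset.card_inv, two_mul]

end Orientation

variable (V)

/-- The system of all directed cycles of the complete directed graph. -/
def directedSystem : CycleSystem V (Arc V) {σ : Equiv.Perm V // σ.IsCycle} :=
  .ofPerms Equiv.Perm.IsCycle (fun _ => id) id (fun _ _ => congrArg Arc.edge)
    (fun σ _ => permArc_injective σ) fun σ τ hσ hτ hne hdisj => by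
      obtain ⟨x, hxσ, hxτ⟩ := Finset.not_disjoint_iff.1 hdisj
      by_contra! hsub
      have hagree : ∀ v ∈ σ.support ∩ τ.support, σ v = τ v := fun v hv => by
        obtain ⟨hvσ, hvτ⟩ := Finset.mem_inter.1 hv
        obtain ⟨u, hu⟩ := mem_permEdges.1 (hsub ⟨v, hvτ⟩ hvσ)
        obtain ⟨huv, hστ⟩ := Prod.ext_iff.1 (Subtype.ext_iff.1 hu)
        exact (congrArg σ huv).symm.trans hστ
      exact hne (hσ.eq_on_support_inter_nonempty_congr hτ hagree
        (hagree x (Finset.mem_inter.2 ⟨hxσ, hxτ⟩)) hxσ)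

/-- The system of all cycles of the complete undirected graph. -/
def undirectedSystem : CycleSystem V (Edge V) {σ : Equiv.Perm V // IsChosenCycle σ} :=
  .ofPerms IsChosenCycle (fun _ h => h.1) Arc.edge (fun _ _ => id)
    (fun _ h => injective_edge_permArc h.1 h.2.1) fun σ τ hσ hτ hne hdisj => by
      by_contra! hsub
      have hagree : ∀ v ∈ σ.support ∩ τ.support, τ v = σ v ∨ σ (τ v) = v := fun v hv => by
        obtain ⟨hvσ, hvτ⟩ := Finset.mem_inter.1 hv
        obtain ⟨u, hu⟩ := mem_permEdges.1 (hsub ⟨v, hvτ⟩ hvσ)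
        exact (Arc.edge_eq_edge_iff.1 hu).imp (fun h => h.2.symm.trans (congrArg σ h.1))
          fun h => (congrArg σ h.1).symm.trans h.2
      rcases eq_or_eq_inv_of_agree hσ.1 hτ.1 hτ.2.1 hdisj hagree with rfl | rfl
      exacts [hne rfl, hσ.not_inv hτ]

variable {V}

/-- The density of a system of cycles of length greater than `m` in which each cycle of length `k`
arises from `r * k` sequences of distinct vertices. -/
def cycleDensity (m r k : ℕ) : ℝ :=
  if m < k then 1 / (r * k) else 0

theorem CycleSystem.hasDensity_cycleDensity {ι : Type*} [Fintype ι] {𝒞 : CycleSystem V E ι}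
    {m r : ℕ} (hr : r ≠ 0) (hm : ∀ a, m < #(𝒞.verts a))
    (hcard : ∀ k, m < k → r * k * #{a | #(𝒞.verts a) = k} = (Fintype.card V).descFactorial k) :
    𝒞.HasDensity (cycleDensity m r) where
  nonneg k := by
    rw [cycleDensity]
    positivity
  card_eq k := by
    rw [cycleDensity]
    split_ifs with hk
    · have hk0 : k ≠ 0 := by omega
      rw [← hcard k hk]
      push_cast
      field_simp
    · rw [zero_mul, Nat.cast_eq_zero, Finset.card_eq_zero, Finset.filter_eq_empty_iff]
      rintro a - rfl
      exact hk (hm a)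

theorem hasDensity_directedSystem : (directedSystem V).HasDensity (cycleDensity 1 1) :=
  CycleSystem.hasDensity_cycleDensity one_ne_zero (fun σ => σ.2.two_le_card_support) fun k hk =>
    (congrArg (1 * k * ·) (card_filter_card_support_subtype _ k)).trans
      (by rw [one_mul, mul_card_filter_isCycle hk])

theorem hasDensity_undirectedSystem : (undirectedSystem V).HasDensity (cycleDensity 2 2) :=
  CycleSystem.hasDensity_cycleDensity two_ne_zero (fun σ => σ.2.2.1) fun k hk =>
    (congrArg (2 * k * ·) (card_filter_card_support_subtype _ k)).trans (by
      rw [mul_right_comm, two_mul_card_filter_isChosenCycle hk, mul_comm,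
        mul_card_filter_isCycle (by omega)])

end Permutations

theorem val_finRotate {k : ℕ} (i : Fin k) : (finRotate k i : ℕ) = (i + 1) % k := by
  have : NeZero k := ⟨i.pos.ne'⟩
  rw [finRotate_apply, Fin.val_add, Fin.val_one', Nat.add_mod_mod]

namespace DirectedCycle

variable {V : Type*} {k : ℕ} (C : DirectedCycle V k)

theorem meanWeight_le_iff {w : Arc V → ℝ} {x : ℝ} :
    C.meanWeight w ≤ x ↔ ∑ i, w (C.arc i) ≤ k * x := by
  have hk : (0 : ℝ) < k := Nat.cast_pos.2 (two_pos.trans_le C.two_le)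
  rw [meanWeight, div_le_iff₀' hk]

variable [Fintype V] [DecidableEq V] {σ : Equiv.Perm V}

/-- The permutation `σ` moves exactly the vertices of `C`, each one to its successor. -/
def Represents (σ : Equiv.Perm V) : Prop :=
  #σ.support = k ∧ ∀ i, σ (C.vertex i) = C.vertex (finRotate k i)

variable {C}

theorem Represents.sum_arc (h : C.Represents σ) (w : Arc V → ℝ) :
    ∑ i, w (C.arc i) = ∑ v, w (permArc σ v) := by
  have hmem : ∀ i, C.vertex i ∈ σ.support := fun i =>
    Equiv.Perm.mem_support.2 fun hi =>
      finRotate_ne_self C.two_le i (C.injective ((h.2 i).symm.trans hi))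
  have hbij : Function.Bijective fun i => (⟨C.vertex i, hmem i⟩ : σ.support) :=
    (Fintype.bijective_iff_injective_and_card _).2
      ⟨fun i j hij => C.injective (congrArg Subtype.val hij), by
        rw [Fintype.card_fin, Fintype.card_coe, h.1]⟩
  exact Fintype.sum_bijective _ hbij _ _ fun i =>
    congrArg w (Subtype.ext (Prod.ext rfl (h.2 i).symm))

theorem Represents.meanWeight_le_iff (h : C.Represents σ) {w : Arc V → ℝ} {x : ℝ} :
    C.meanWeight w ≤ x ↔ ∑ v, w (permArc σ v) ≤ #σ.support * x := by
  rw [C.meanWeight_le_iff, h.sum_arc, h.1]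

variable (C) in
theorem exists_represents : ∃ σ : Equiv.Perm V, σ.IsCycle ∧ C.Represents σ := by
  let f : Fin k ↪ V := ⟨C.vertex, C.injective⟩
  refine ⟨(finRotate k).viaFintypeEmbedding f, (isCycle_finRotate_of_le C.two_le).extendDomain _,
    ?_, (finRotate k).viaFintypeEmbedding_apply_image f⟩
  rw [Equiv.Perm.viaFintypeEmbedding, Equiv.Perm.card_support_extend_domain,
    support_finRotate_of_le C.two_le, Finset.card_univ, Fintype.card_fin]

end DirectedCycle

section CyclesAsPermutations

variable {V : Type*} [Fintype V] [DecidableEq V] {σ : Equiv.Perm V}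

theorem exists_directedCycle_represents (hσ : σ.IsCycle) :
    ∃ C : DirectedCycle V #σ.support, C.Represents σ := by
  have hk : 2 ≤ #σ.support := hσ.two_le_card_support
  obtain ⟨v, hv, -⟩ := id hσ
  have hmod : ∀ i j : ℕ, (σ ^ i) v = (σ ^ j) v ↔ i ≡ j [MOD #σ.support] := fun i j => by
    rw [← hσ.orderOf, ← pow_eq_pow_iff_modEq]
    exact ⟨fun h => hσ.pow_eq_pow_iff.2 ⟨v, hv, h⟩, fun h => by rw [h]⟩
  refine ⟨⟨hk, fun i => (σ ^ (i : ℕ)) v, fun i j hij =>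
    Fin.ext (((hmod i j).1 hij).eq_of_lt_of_lt i.2 j.2)⟩, rfl, fun i => ?_⟩
  change σ ((σ ^ (i : ℕ)) v) = (σ ^ (finRotate _ i : ℕ)) v
  rw [← Equiv.Perm.mul_apply, ← pow_succ', hmod, val_finRotate]
  exact (Nat.mod_modEq _ _).symm

theorem exists_directedCycle_meanWeight_le_iff (w : Arc V → ℝ) (x : ℝ) (m : ℕ) :
    (∃ k ≥ m, ∃ C : DirectedCycle V k, C.meanWeight w ≤ x) ↔
      ∃ σ : Equiv.Perm V, σ.IsCycle ∧ m ≤ #σ.support ∧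
        ∑ v, w (permArc σ v) ≤ #σ.support * x := by
  constructor
  · rintro ⟨k, hm, C, hC⟩
    obtain ⟨σ, hσ, h⟩ := C.exists_represents
    exact ⟨σ, hσ, h.1 ▸ hm, h.meanWeight_le_iff.1 hC⟩
  · rintro ⟨σ, hσ, hm, hw⟩
    obtain ⟨C, h⟩ := exists_directedCycle_represents hσ
    exact ⟨_, hm, C, h.meanWeight_le_iff.2 hw⟩

theorem mem_light_directedSystem {w : Arc V → ℝ} {x : ℝ} {a : {σ : Equiv.Perm V // σ.IsCycle}} :
    w ∈ (directedSystem V).light x a ↔ ∑ v, w (permArc a.1 v) ≤ #a.1.support * x := by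
  change ∑ e ∈ permEdges id a.1, w e ≤ _ ↔ _
  rw [sum_permEdges (permArc_injective a.1)]
  rfl

theorem hasLightDirectedCycle_iff {w : Arc V → ℝ} {x : ℝ} :
    HasLightDirectedCycle w x ↔ ∃ a, w ∈ (directedSystem V).light x a := by
  simpa only [HasLightDirectedCycle, mem_light_directedSystem, Subtype.exists, ← exists_prop,
    zero_le, exists_true_left, ge_iff_le] using exists_directedCycle_meanWeight_le_iff w x 0

theorem mem_light_undirectedSystem {w : Edge V → ℝ} {x : ℝ}
    {a : {σ : Equiv.Perm V // IsChosenCycle σ}} :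
    w ∈ (undirectedSystem V).light x a ↔ ∑ v, w (permArc a.1 v).edge ≤ #a.1.support * x := by
  rw [← sum_permEdges (injective_edge_permArc a.2.1 a.2.2.1)]
  rfl

end CyclesAsPermutations

section Walks

variable {V : Type*} {w : Edge V → ℝ} {x : ℝ}

theorem walkMeanWeight_eq {u v : V} (p : (⊤ : SimpleGraph V).Walk u v) :
    walkMeanWeight w p =
      (∑ i : Fin p.length, w ⟨s(p.getVert i, p.getVert (i + 1)), p.adj_getVert_succ i.2⟩) /
        p.length := by
  rw [walkMeanWeight, ← List.sum_ofFn]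
  congr 2
  refine List.ext_getElem (by simp) fun i _ _ => ?_
  simp [SimpleGraph.Walk.getElem_edges]

theorem walkMeanWeight_eq_meanWeight {u : V} {p : (⊤ : SimpleGraph V).Walk u u} {k : ℕ}
    {C : DirectedCycle V k} (hk : p.length = k) (hC : ∀ i : Fin k, C.vertex i = p.getVert i) :
    walkMeanWeight w p = C.meanWeight fun a => w a.edge := by
  subst hk
  rw [walkMeanWeight_eq, DirectedCycle.meanWeight]
  congr 1
  refine Finset.sum_congr rfl fun i _ => congrArg w (Subtype.ext ?_)
  have hnext : C.vertex (finRotate _ i) = p.getVert (i + 1) := by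
    rw [hC, val_finRotate]
    obtain hi | hi := (Order.add_one_le_of_lt i.2).lt_or_eq
    · rw [Nat.mod_eq_of_lt hi]
    · rw [hi, Nat.mod_self, p.getVert_zero, p.getVert_length]
  exact congrArg₂ (s(·, ·)) (hC i).symm hnext.symm

theorem exists_directedCycle_vertex_eq_getVert {u : V} {p : (⊤ : SimpleGraph V).Walk u u}
    (hp : p.IsCycle) :
    ∃ C : DirectedCycle V p.length, ∀ i : Fin p.length, C.vertex i = p.getVert i :=
  ⟨⟨by linarith [hp.three_le_length], fun i => p.getVert i, fun i j h => Fin.ext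
    (hp.getVert_injOn' (Nat.le_pred_of_lt i.2) (Nat.le_pred_of_lt j.2) h)⟩, fun _ => rfl⟩

open SimpleGraph in
theorem DirectedCycle.exists_isCycle_getVert_eq_vertex {k : ℕ} (C : DirectedCycle V k)
    (hk : 3 ≤ k) : ∃ (u : V) (p : (⊤ : SimpleGraph V).Walk u u),
      p.IsCycle ∧ p.length = k ∧ ∀ i : Fin k, C.vertex i = p.getVert i := by
  obtain ⟨n, rfl⟩ := Nat.exists_eq_add_of_le' hk
  let f : cycleGraph (n + 3) →g (⊤ : SimpleGraph V) := ⟨C.vertex, fun h => C.injective.ne h.ne⟩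
  refine ⟨_, (cycleGraph.cycle n).reverse.map f, ?_, by simp, fun i => ?_⟩
  · exact (Walk.isCycle_map_iff_of_injective C.injective).2 cycleGraph.isCycle_cycle.reverse
  · -- `cycleGraph.cycle` runs through `Fin (n + 3)` downwards, hence the reversal.
    rw [Walk.getVert_map, Walk.getVert_reverse, cycleGraph.getVert_cycle (by simp)]
    refine congrArg C.vertex (Fin.ext ?_)
    simp [Nat.sub_sub_self i.2.le, Nat.mod_eq_of_lt i.2]

theorem hasLightCycle_iff_exists_directedCycle :
    HasLightCycle w x ↔ ∃ k ≥ 3, ∃ C : DirectedCycle V k, C.meanWeight (fun a => w a.edge) ≤ x := by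
  constructor
  · rintro ⟨u, p, hp, hw⟩
    obtain ⟨C, hC⟩ := exists_directedCycle_vertex_eq_getVert hp
    exact ⟨_, hp.three_le_length, C, (walkMeanWeight_eq_meanWeight rfl hC).ge.trans hw⟩
  · rintro ⟨k, hk, C, hw⟩
    obtain ⟨u, p, hp, hlen, hC⟩ := C.exists_isCycle_getVert_eq_vertex hk
    exact ⟨u, p, hp, (walkMeanWeight_eq_meanWeight hlen hC).trans_le hw⟩

theorem hasLightCycle_iff [Fintype V] [DecidableEq V] :
    HasLightCycle w x ↔ ∃ a, w ∈ (undirectedSystem V).light x a := by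
  simp only [hasLightCycle_iff_exists_directedCycle, exists_directedCycle_meanWeight_le_iff,
    Subtype.exists, mem_light_undirectedSystem]
  constructor
  · rintro ⟨σ, hσ, h3, hw⟩
    obtain h | h := isChosenCycle_or_inv hσ h3
    · exact ⟨σ, h, hw⟩
    · refine ⟨σ⁻¹, h, ?_⟩
      rwa [← sum_permEdges (injective_edge_permArc h.1 h.2.1), permEdges_edge_inv,
        sum_permEdges (injective_edge_permArc hσ h3), Equiv.Perm.support_inv]
  · rintro ⟨σ, hσ, hw⟩
    exact ⟨σ, hσ.1, hσ.2.1, hw⟩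

end Walks

/-! ### The tree function and the limit laws -/

section TreeFunction

/-- The `k`-th term of the series of the tree function, with its index shift. -/
def treeTerm (z : ℝ) (k : ℕ) : ℝ :=
  ((k + 1 : ℕ) : ℝ) ^ k * z ^ (k + 1) / ((k + 1).factorial : ℝ)

theorem treeTerm_succ (z : ℝ) (k : ℕ) :
    treeTerm z (k + 1) = z * (1 + 1 / ((k + 1 : ℕ) : ℝ)) ^ k * treeTerm z k := by
  have hk : (1 : ℝ) + 1 / ((k + 1 : ℕ) : ℝ) = ((k + 2 : ℕ) : ℝ) / ((k + 1 : ℕ) : ℝ) := by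
    push_cast
    field_simp
    ring
  rw [treeTerm, treeTerm, hk, div_pow, Nat.factorial_succ (k + 1)]
  push_cast
  field_simp
  ring

theorem tendsto_one_add_one_div_pow_exp :
    Tendsto (fun k : ℕ => (1 + 1 / ((k + 1 : ℕ) : ℝ)) ^ k) atTop (𝓝 (Real.exp 1)) := by
  have hpow : Tendsto (fun k : ℕ => (1 + 1 / ((k + 1 : ℕ) : ℝ)) ^ (k + 1)) atTop
      (𝓝 (Real.exp 1)) := (Real.tendsto_one_add_div_pow_exp 1).comp (tendsto_add_atTop_nat 1)
  have hbase : Tendsto (fun k : ℕ => 1 + 1 / ((k + 1 : ℕ) : ℝ)) atTop (𝓝 1) := by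
    simpa using ((tendsto_const_div_atTop_nhds_zero_nat (1 : ℝ)).comp
      (tendsto_add_atTop_nat 1)).const_add 1
  refine (div_one (Real.exp 1) ▸ hpow.div hbase one_ne_zero).congr fun k => ?_
  rw [Pi.div_apply, pow_succ, mul_div_cancel_right₀ _ (by positivity)]

theorem not_summable_treeTerm {c : ℝ} (hc : 1 / Real.exp 1 < c) : ¬Summable (treeTerm c) := by
  have hc0 : 0 < c := (by positivity : (0 : ℝ) < 1 / Real.exp 1).trans hc
  have hpos : ∀ k, 0 < treeTerm c k := fun k => by unfold treeTerm; positivity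
  refine not_summable_of_ratio_test_tendsto_gt_one ((div_lt_iff₀ (Real.exp_pos 1)).1 hc)
    ((tendsto_one_add_one_div_pow_exp.const_mul c).congr fun k => ?_)
  rw [Real.norm_of_nonneg (hpos _).le, Real.norm_of_nonneg (hpos _).le, treeTerm_succ,
    mul_div_cancel_right₀ _ (hpos k).ne']

theorem continuousOn_treeFunction :
    ContinuousOn treeFunction (Set.Icc (-(1 / Real.exp 1)) (1 / Real.exp 1)) := by
  have he : 0 < 1 / Real.exp 1 := by positivity
  refine continuousOn_tsum (u := treeTerm (1 / Real.exp 1)) (fun k => by fun_prop)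
    (summable_treeFunction (abs_of_pos he).le) fun k z hz => ?_
  rw [treeTerm, norm_div, norm_mul, norm_pow, norm_pow, Real.norm_natCast, Real.norm_natCast,
    Real.norm_eq_abs]
  gcongr
  exact abs_le.2 hz

end TreeFunction

section LightIntensity

open CycleSystem

variable {m r : ℕ} {c : ℝ}

theorem lightIntensity_cycleDensity_of_le {k : ℕ} (hk : k ≤ m) :
    lightIntensity (cycleDensity m r) c k = 0 := by
  rw [lightIntensity, cycleDensity, if_neg hk.not_gt, zero_mul]

theorem lightIntensity_cycleDensity_add (j : ℕ) :
    lightIntensity (cycleDensity m r) c (j + (m + 1)) = 1 / r * treeTerm c (j + m) := by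
  rw [lightIntensity, cycleDensity, if_pos (by omega), treeTerm, ← add_assoc, mul_pow,
    pow_succ ((j + m + 1 : ℕ) : ℝ) (j + m)]
  field_simp

theorem summable_lightIntensity_cycleDensity_iff (hr : r ≠ 0) :
    Summable (lightIntensity (cycleDensity m r) c) ↔ Summable (treeTerm c) := by
  rw [← summable_nat_add_iff (m + 1), ← summable_nat_add_iff (f := treeTerm c) m]
  simp_rw [lightIntensity_cycleDensity_add]
  exact summable_mul_left_iff (by positivity)

theorem tsum_lightIntensity_cycleDensity (hr : r ≠ 0) (h : Summable (treeTerm c)) :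
    ∑' k, lightIntensity (cycleDensity m r) c k =
      1 / r * (treeFunction c - ∑ j ∈ Finset.range m, treeTerm c j) := by
  have hshort : ∑ k ∈ Finset.range (m + 1), lightIntensity (cycleDensity m r) c k = 0 :=
    Finset.sum_eq_zero fun k hk =>
      lightIntensity_cycleDensity_of_le (Nat.le_of_lt_succ (Finset.mem_range.1 hk))
  have htree : ∑ j ∈ Finset.range m, treeTerm c j + ∑' j, treeTerm c (j + m) = treeFunction c :=
    h.sum_add_tsum_nat_add m
  rw [← ((summable_lightIntensity_cycleDensity_iff hr).2 h).sum_add_tsum_nat_add (m + 1), hshort,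
    zero_add, ← htree, add_sub_cancel_left]
  simp_rw [lightIntensity_cycleDensity_add, tsum_mul_left]

end LightIntensity

theorem jumpsToOneAt_of_eq {F G : ℝ → ℝ} {r : ℝ} (hr : 0 < r)
    (hF : ∀ c, F c = if c ≤ r then 1 - Real.exp (G c) else 1)
    (hG : ContinuousOn G (Set.Icc (-r) r)) : JumpsToOneAt F r := by
  have hF_le : ∀ c ≤ r, F c = 1 - Real.exp (G c) := fun c hc => by rw [hF, if_pos hc]
  have hF_gt : ∀ c > r, F c = 1 := fun c hc => by rw [hF, if_neg (not_le.2 hc)]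
  refine ⟨?_, ?_, ?_⟩
  · rw [hF_le r le_rfl]
    exact sub_lt_self _ (Real.exp_pos _)
  · have hcont : ContinuousOn F (Set.Icc (-r) r) :=
      (continuousOn_const.sub hG.rexp).congr fun c hc => hF_le c hc.2
    rw [← nhdsWithin_Ioo_eq_nhdsLT (by linarith : -r < r)]
    exact (hcont r ⟨by linarith, le_rfl⟩).mono Set.Ioo_subset_Icc_self
  · exact tendsto_const_nhds.congr' (eventually_nhdsWithin_of_forall fun c hc => (hF_gt c hc).symm)

section LimitLaw

theorem measureReal_exists_light {V E ι Ω : Type*} [Fintype E] [Fintype ι] [MeasurableSpace Ω]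
    [DecidableEq V] [DecidableEq E] {P : Measure Ω} [IsProbabilityMeasure P] {W : E → Ω → ℝ}
    (hW : IsIIDExp P W) (𝒞 : CycleSystem V E ι) (x : ℝ) :
    P.real {ω | ∃ a, (fun e => W e ω) ∈ 𝒞.light x a} =
      1 - (expWeights E).real (𝒞.noLight x .univ) := by
  have hlaw : HasLaw (fun ω e => W e ω) (expWeights E) P :=
    (iIndepFun_iff_hasLaw_pi_pi hW.1).1 hW.2
  have hmeas : MeasurableSet {w | ∃ a, w ∈ 𝒞.light x a} := by
    rw [Set.ofPred_exists]
    exact MeasurableSet.iUnion fun a => 𝒞.measurableSet_light x a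
  have hcompl : 𝒞.noLight x .univ = {w | ∃ a, w ∈ 𝒞.light x a}ᶜ := by
    ext w
    simp [CycleSystem.noLight]
  rw [hlaw.measureReal_eq hmeas, hcompl, probReal_compl_eq_one_sub hmeas, sub_sub_cancel]

variable {E ι : ℕ → Type*} [∀ n, Finite (E n)] [∀ n, DecidableEq (E n)] [∀ n, Fintype (ι n)]
  {𝒞 : ∀ n, CycleSystem (Fin n) (E n) (ι n)} {m r : ℕ} {Ω : ℕ → Type*}
  [∀ n, MeasurableSpace (Ω n)] {P : ∀ n, Measure (Ω n)} [∀ n, IsProbabilityMeasure (P n)] {c : ℝ}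

theorem tendsto_measureReal_exists_light (h𝒞 : ∀ n, (𝒞 n).HasDensity (cycleDensity m r))
    (hr : r ≠ 0) {W : ∀ n, E n → Ω n → ℝ} (hW : ∀ n, IsIIDExp (P n) (W n)) (hc : 0 ≤ c) :
    Tendsto (fun n : ℕ => (P n).real {ω | ∃ a, (fun e => W n e ω) ∈ (𝒞 n).light (c / n) a})
      atTop (𝓝 (if c ≤ 1 / Real.exp 1 then
        1 - Real.exp (-(1 / r * (treeFunction c - ∑ j ∈ Finset.range m, treeTerm c j)))
        else 1)) := by
  have := fun n => Fintype.ofFinite (E n)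
  simp_rw [measureReal_exists_light (hW _)]
  split_ifs with h
  · have hs : Summable (treeTerm c) := summable_treeFunction (by rwa [abs_of_nonneg hc])
    rw [← tsum_lightIntensity_cycleDensity hr hs]
    exact (CycleSystem.tendsto_measureReal_noLight_of_summable h𝒞 hc
      ((summable_lightIntensity_cycleDensity_iff hr).2 hs)).const_sub 1
  · simpa only [sub_zero] using
      (CycleSystem.tendsto_measureReal_noLight_of_not_summable h𝒞 hc
        ((summable_lightIntensity_cycleDensity_iff hr).not.2
          (not_summable_treeTerm (not_le.1 h)))).const_sub 1

theorem tendsto_directed {W : ∀ n, Arc (Fin n) → Ω n → ℝ} (hW : ∀ n, IsIIDExp (P n) (W n))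
    (hc : 0 ≤ c) :
    Tendsto (fun n : ℕ => (P n).real {ω | HasLightDirectedCycle (fun a => W n a ω) (c / n)})
      atTop (𝓝 (directedLimit c)) := by
  simp_rw [hasLightDirectedCycle_iff]
  convert! tendsto_measureReal_exists_light (fun _ => hasDensity_directedSystem) one_ne_zero hW hc
    using 2
  rw [directedLimit]
  congr 3
  simp only [Finset.sum_range_one, treeTerm]
  norm_num
  ring

theorem tendsto_undirected {W : ∀ n, Edge (Fin n) → Ω n → ℝ} (hW : ∀ n, IsIIDExp (P n) (W n))
    (hc : 0 ≤ c) :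
    Tendsto (fun n : ℕ => (P n).real {ω | HasLightCycle (fun e => W n e ω) (c / n)})
      atTop (𝓝 (undirectedLimit c)) := by
  simp_rw [hasLightCycle_iff]
  convert! tendsto_measureReal_exists_light (fun _ => hasDensity_undirectedSystem) two_ne_zero hW hc
    using 2
  rw [undirectedLimit]
  congr 3
  simp only [Finset.sum_range_succ, Finset.sum_range_zero, treeTerm]
  norm_num
  ring

end LimitLaw

end

end MinMeanCycle

theorem mainTheorem1 :
    (∀ (Ω : ℕ → Type*) [∀ n, MeasurableSpace (Ω n)] (P : ∀ n, Measure (Ω n))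
        [∀ n, IsProbabilityMeasure (P n)] (W : ∀ n, MinMeanCycle.Arc (Fin n) → Ω n → ℝ),
        (∀ n, MinMeanCycle.IsIIDExp (P n) (W n)) → ∀ c : ℝ, 0 ≤ c →
        Tendsto
          (fun n : ℕ =>
            (P n).real {ω | MinMeanCycle.HasLightDirectedCycle (fun a => W n a ω) (c / n)})
          atTop (𝓝 (MinMeanCycle.directedLimit c))) ∧
    (∀ (Ω : ℕ → Type*) [∀ n, MeasurableSpace (Ω n)] (P : ∀ n, Measure (Ω n))
        [∀ n, IsProbabilityMeasure (P n)] (W : ∀ n, MinMeanCycle.Edge (Fin n) → Ω n → ℝ),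
        (∀ n, MinMeanCycle.IsIIDExp (P n) (W n)) → ∀ c : ℝ, 0 ≤ c →
        Tendsto
          (fun n : ℕ =>
            (P n).real {ω | MinMeanCycle.HasLightCycle (fun e => W n e ω) (c / n)})
          atTop (𝓝 (MinMeanCycle.undirectedLimit c))) ∧
    MinMeanCycle.JumpsToOneAt MinMeanCycle.directedLimit (1 / Real.exp 1) ∧
    MinMeanCycle.JumpsToOneAt MinMeanCycle.undirectedLimit (1 / Real.exp 1) := by
  refine ⟨fun _ _ _ _ _ hW _ hc => MinMeanCycle.tendsto_directed hW hc,
    fun _ _ _ _ _ hW _ hc => MinMeanCycle.tendsto_undirected hW hc,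
    MinMeanCycle.jumpsToOneAt_of_eq (by positivity) (fun _ => rfl) ?_,
    MinMeanCycle.jumpsToOneAt_of_eq (by positivity) (fun _ => rfl) ?_⟩
  · exact MinMeanCycle.continuousOn_treeFunction.neg.add continuousOn_id
  · exact ((MinMeanCycle.continuousOn_treeFunction.neg.add continuousOn_id).add
      (continuousOn_id.pow 2)).div_const 2
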